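/- Let $N$ be a finite set of individuals. A profile over $N$ is a map $\varphi:N\times N\to\{0,1\}$; $a$ qualifies $b$ if $\varphi(a,b)=1$. For $T\subseteq N$ put $K_0(\varphi,T)=\{a\in T:\varphi(a,a)=1\}$ and, for $i\ge 1$, $K_i(\varphi,T)=K_{i-1}(\varphi,T)\cup\{a\in T:\varphi(b,a)=1\text{ for some }b\in K_{i-1}(\varphi,T)\}$. The liberal-start-respecting rule $f^{\mathrm{LSR}}$ selects the set $f^{\mathrm{LSR}}(\varphi,T)=K_i(\varphi,T)$, where $i\ge1$ is any integer with $K_i(\varphi,T)=K_{i-1}(\varphi,T)$. Group Control by Adding Individuals (GCAI) for $f^{\mathrm{LSR}}$ is the following problem. Given a finite set $N$ of individuals, a profile $\varphi$ over $N$, two nonempty sets $S\subseteq T\subseteq N$ and an integer $k$, is there a set $U\subseteq N\setminus T$ with $|U|\le k$ and $S\subseteq f^{\mathrm{LSR}}(\varphi,T\cup U)$? The members of $S$ are the distinguished individuals, and the parameter is $\ell=|S|$. With instances encoded as binary words (the size of $N$ in unary, $\varphi$ as a matrix, $S$ and $T$ as characteristic words, $k$ in binary), GCAI is the set of all pairs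 (encoding of a yes-instance, its parameter) in $\{0,1\}^*\times\mathbb N$. Running times are measured on a random access machine with logarithmic cost, i.e. every operation is charged the binary lengths of the numbers and memory addresses it handles (multiplication and division are charged the product of the lengths of their operands). **Theorem.** GCAI for $f^{\mathrm{LSR}}$ is fixed-parameter tractable with respect to the number $\ell$ of distinguished individuals: some algorithm decides, for every $(x,\kappa)\in\{0,1\}^*\times\mathbb N$, whether $(x,\kappa)$ belongs to the problem, in time $g(\kappa)\cdot|x|^{O(1)}$ with a computable function $g$. More precisely, GCAI for $f^{\mathrm{LSR}}$ can be solved in $O^*(2^\ell)$ time, that is, in time $O\bigl(2^{\ell}\cdot|x|^{O(1)}\bigr)$, where $|x|$ is the length of the input word (with $|x|+1$ in place of $|x|$, in both bounds, so that the empty word is covered). -/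

import Mathlib

/-! ### Random access machines with logarithmic cost -/

namespace RAM

/-- A configuration: finitely many registers are used by a program (addressed directly), and there
is an unbounded memory that is addressed indirectly. All cells hold natural numbers. -/
structure State where
  reg : ℕ → ℕ
  mem : ℕ → ℕ

/-- Write `v` into register `d`. -/
def State.setReg (s : State) (d v : ℕ) : State :=
  { s with reg := Function.update s.reg d v }

/-- Write `v` into memory cell `a`. -/
def State.setMem (s : State) (a v : ℕ) : State :=
  { s with mem := Function.update s.mem a v }

/-- Structured programs for the random access machine. The arguments are names of registers,
except for the number `c` in `const d c`. -/
inductive Prog where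
  /-- do nothing -/
  | skip : Prog
  /-- `R[d] := c` -/
  | const (d c : ℕ) : Prog
  /-- `R[d] := R[a]` -/
  | copy (d a : ℕ) : Prog
  /-- `R[d] := R[a] + R[b]` -/
  | add (d a b : ℕ) : Prog
  /-- `R[d] := max (R[a] - R[b]) 0` -/
  | sub (d a b : ℕ) : Prog
  /-- `R[d] := R[a] * R[b]` -/
  | mul (d a b : ℕ) : Prog
  /-- `R[d] := ⌊R[a] / R[b]⌋` (and `0` if `R[b] = 0`) -/
  | div (d a b : ℕ) : Prog
  /-- `R[d] := M[R[a]]` -/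
  | load (d a : ℕ) : Prog
  /-- `M[R[a]] := R[b]` -/
  | store (a b : ℕ) : Prog
  /-- first `p`, then `q` -/
  | seq (p q : Prog) : Prog
  /-- if `R[a] ≠ 0` then `p` else `q` -/
  | branch (a : ℕ) (p q : Prog) : Prog
  /-- while `R[a] ≠ 0` do `p` -/
  | loop (a : ℕ) (p : Prog) : Prog

/-- The cost of handling the number `v`: its binary length plus one. -/
def len (v : ℕ) : ℕ := Nat.size v + 1

/-- `Exec p s t c`: the program `p`, started in the configuration `s`, halts in the
configuration `t`, and the run has cost `c`. Every operation is charged the binary lengths of all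
the numbers and memory addresses that it handles; multiplication and division are charged the
cost of the schoolbook method. -/
inductive Exec : Prog → State → State → ℕ → Prop where
  | skip (s : State) : Exec .skip s s 1
  | const (s : State) (d c : ℕ) : Exec (.const d c) s (s.setReg d c) (len c)
  | copy (s : State) (d a : ℕ) : Exec (.copy d a) s (s.setReg d (s.reg a)) (len (s.reg a))
  | add (s : State) (d a b : ℕ) :
      Exec (.add d a b) s (s.setReg d (s.reg a + s.reg b)) (len (s.reg a) + len (s.reg b))
  | sub (s : State) (d a b : ℕ) :
      Exec (.sub d a b) s (s.setReg d (s.reg a - s.reg b)) (len (s.reg a) + len (s.reg b))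
  | mul (s : State) (d a b : ℕ) :
      Exec (.mul d a b) s (s.setReg d (s.reg a * s.reg b)) (len (s.reg a) * len (s.reg b))
  | div (s : State) (d a b : ℕ) :
      Exec (.div d a b) s (s.setReg d (s.reg a / s.reg b)) (len (s.reg a) * len (s.reg b))
  | load (s : State) (d a : ℕ) :
      Exec (.load d a) s (s.setReg d (s.mem (s.reg a)))
        (len (s.reg a) + len (s.mem (s.reg a)))
  | store (s : State) (a b : ℕ) :
      Exec (.store a b) s (s.setMem (s.reg a) (s.reg b)) (len (s.reg a) + len (s.reg b))
  | seq {p q : Prog} {s t u : State} {c d : ℕ} (hp : Exec p s t c) (hq : Exec q t u d) :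
      Exec (.seq p q) s u (c + d)
  | branch_true {a : ℕ} {p q : Prog} {s t : State} {c : ℕ} (ha : s.reg a ≠ 0)
      (hp : Exec p s t c) : Exec (.branch a p q) s t (len (s.reg a) + c)
  | branch_false {a : ℕ} {p q : Prog} {s t : State} {c : ℕ} (ha : s.reg a = 0)
      (hq : Exec q s t c) : Exec (.branch a p q) s t (len (s.reg a) + c)
  | loop_done {a : ℕ} {p : Prog} {s : State} (ha : s.reg a = 0) :
      Exec (.loop a p) s s (len (s.reg a))
  | loop_step {a : ℕ} {p : Prog} {s t u : State} {c d : ℕ} (ha : s.reg a ≠ 0)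
      (hp : Exec p s t c) (hl : Exec (.loop a p) t u d) :
      Exec (.loop a p) s u (len (s.reg a) + c + d)

/-- Runs are deterministic: the final configuration and the cost are unique. -/
theorem Exec.unique {p : Prog} {s t t' : State} {c c' : ℕ} (h : Exec p s t c)
    (h' : Exec p s t' c') : t = t' ∧ c = c' := by
  induction h generalizing t' c' with
  | seq _ _ ihp ihq =>
    cases h' with
    | seq hp hq =>
      obtain ⟨rfl, rfl⟩ := ihp hp
      obtain ⟨rfl, rfl⟩ := ihq hq
      exact ⟨rfl, rfl⟩
  | branch_true ha _ ih =>
    cases h' with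
    | branch_true _ hp =>
      obtain ⟨rfl, rfl⟩ := ih hp
      exact ⟨rfl, rfl⟩
    | branch_false hb _ => exact absurd hb ha
  | branch_false ha _ ih =>
    cases h' with
    | branch_true hb _ => exact absurd ha hb
    | branch_false _ hq =>
      obtain ⟨rfl, rfl⟩ := ih hq
      exact ⟨rfl, rfl⟩
  | loop_done ha =>
    cases h' with
    | loop_done _ => exact ⟨rfl, rfl⟩
    | loop_step hb _ _ => exact absurd ha hb
  | loop_step ha _ _ ihp ihl =>
    cases h' with
    | loop_done hb => exact absurd hb ha
    | loop_step _ hp hl =>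
      obtain ⟨rfl, rfl⟩ := ihp hp
      obtain ⟨rfl, rfl⟩ := ihl hl
      exact ⟨rfl, rfl⟩
  | _ => cases h'; exact ⟨rfl, rfl⟩

/-- The initial configuration on the input `(x, κ)`: the length of the word `x` is in register
`0`, the parameter `κ` is in register `1`, the letters of `x` are in the memory cells
`0, 1, …, |x| - 1`, and everything else is `0`. -/
def init (x : List Bool) (κ : ℕ) : State where
  reg i := if i = 0 then x.length else if i = 1 then κ else 0
  mem i := (x.getD i false).toNat

end RAM

/-! ### Parameterized problems -/

/-- A parameterized problem: a subset of `Σ* × ℕ`, where `Σ = {0, 1}`. -/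
abbrev ParamProblem : Type := Set (List Bool × ℕ)

namespace ParamProblem

/-- On every input `(x, κ)`, the program `P` halts within cost `time x κ`, with a `1` in
register `0` if `(x, κ)` belongs to `L`, and with a `0` there if it does not. -/
def DecidedInTime (L : ParamProblem) (P : RAM.Prog) (time : List Bool → ℕ → ℕ) : Prop :=
  ∀ (x : List Bool) (κ : ℕ), ∃ (t : RAM.State) (c : ℕ),
    RAM.Exec P (RAM.init x κ) t c ∧ c ≤ time x κ ∧
      ((x, κ) ∈ L → t.reg 0 = 1) ∧ ((x, κ) ∉ L → t.reg 0 = 0)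

/-- `L` is fixed-parameter tractable: it is decided in time `f(κ) · |x|^{O(1)}` for some computable
`f`. (The bound is written with `|x| + 1` so that it makes sense for the empty word.) -/
def IsFPT (L : ParamProblem) : Prop :=
  ∃ (P : RAM.Prog) (f : ℕ → ℕ) (c : ℕ), Computable f ∧
    L.DecidedInTime P fun x κ => f κ * (x.length + 1) ^ c

/-- `L` can be solved in `O*(g(κ))` time: in time `O(g(κ) · |x|^{O(1)})`. -/
def SolvableInOStar (L : ParamProblem) (g : ℕ → ℕ) : Prop :=
  ∃ (P : RAM.Prog) (C c : ℕ),
    L.DecidedInTime P fun x κ => C * g κ * (x.length + 1) ^ c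

end ParamProblem

/-! ### Group identification -/

namespace GroupIdentification

/-- A profile over the set `N`: `φ a b` tells whether `a` qualifies `b`. -/
abbrev Profile (N : Type) : Type := N → N → Bool

/-- A social aggregation rule, on the sets of individuals `{0, …, n - 1}`. -/
structure AggregationRule where
  select : ∀ {n : ℕ}, Profile (Fin n) → Finset (Fin n) → Finset (Fin n)
  select_subset : ∀ {n : ℕ} (φ : Profile (Fin n)) (T : Finset (Fin n)), select φ T ⊆ T

section Liberal

variable {N : Type} [DecidableEq N]

/-- The stages `K_0, K_1, …` of the liberal-start-respecting rule. -/
def liberalStage (φ : Profile N) (T : Finset N) : ℕ → Finset N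
  | 0 => T.filter fun a => φ a a = true
  | i + 1 => liberalStage φ T i ∪ T.filter fun a => ∃ b ∈ liberalStage φ T i, φ b a = true

open Classical in
/-- The individuals selected by the liberal-start-respecting rule: those that enter at some stage.
By `liberal_eq_stage` this is `K_i` for every `i` at which the stages have become stationary. -/
noncomputable def liberal (φ : Profile N) (T : Finset N) : Finset N :=
  T.filter fun a => ∃ i, a ∈ liberalStage φ T i

theorem liberalStage_subset (φ : Profile N) (T : Finset N) (i : ℕ) :
    liberalStage φ T i ⊆ T := by
  induction i with
  | zero => exact Finset.filter_subset _ _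
  | succ i ih => exact Finset.union_subset ih (Finset.filter_subset _ _)

theorem liberalStage_mono (φ : Profile N) (T : Finset N) : Monotone (liberalStage φ T) :=
  monotone_nat_of_le_succ fun _ => Finset.subset_union_left

theorem liberal_eq_stage (φ : Profile N) (T : Finset N) (i : ℕ)
    (h : liberalStage φ T (i + 1) = liberalStage φ T i) :
    liberal φ T = liberalStage φ T (i + 1) := by
  have key : ∀ j, liberalStage φ T (i + j) = liberalStage φ T i := by
    intro j
    induction j with
    | zero => rfl
    | succ j ih =>
      rw [← h, ← Nat.add_assoc]
      simp only [liberalStage, ih]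
  ext a
  simp only [liberal, Finset.mem_filter]
  constructor
  · rintro ⟨_, j, hj⟩
    rw [h, ← key j]
    exact liberalStage_mono φ T (Nat.le_add_left j i) hj
  · exact fun ha => ⟨liberalStage_subset φ T _ ha, _, ha⟩

theorem exists_liberalStage_stable (φ : Profile N) (T : Finset N) :
    ∃ i, liberalStage φ T (i + 1) = liberalStage φ T i := by
  by_contra! hne
  have grow : ∀ i, i ≤ (liberalStage φ T i).card := by
    intro i
    induction i with
    | zero => exact Nat.zero_le _
    | succ i ih =>
      have hlt : (liberalStage φ T i).card < (liberalStage φ T (i + 1)).card :=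
        Finset.card_lt_card ((liberalStage_mono φ T (Nat.le_succ i)).lt_of_ne (hne i).symm)
      omega
  have h1 := grow (T.card + 1)
  have h2 := Finset.card_le_card (liberalStage_subset φ T (T.card + 1))
  omega

end Liberal

/-- The liberal-start-respecting rule `f^LSR`. -/
noncomputable def LSR : AggregationRule where
  select φ T := liberal φ T
  select_subset φ T a h := by
    classical
    exact (Finset.mem_filter.mp h).1

/-! ### Group control by adding individuals -/

/-- An instance `(N, φ, S, T, k)`, with `N = {0, …, n - 1}`. -/
structure Instance where
  n : ℕ
  φ : Profile (Fin n)
  S : Finset (Fin n)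
  T : Finset (Fin n)
  k : ℤ
  S_nonempty : S.Nonempty
  T_nonempty : T.Nonempty
  S_subset_T : S ⊆ T

/-- Some set `U ⊆ N \ T` with `|U| ≤ k` satisfies `S ⊆ f(φ, T ∪ U)`. -/
def Instance.IsYes (f : AggregationRule) (I : Instance) : Prop :=
  ∃ U : Finset (Fin I.n), U ⊆ Finset.univ \ I.T ∧ (U.card : ℤ) ≤ I.k ∧
    I.S ⊆ f.select I.φ (I.T ∪ U)

/-- The characteristic word of a set of individuals. -/
def charWord {n : ℕ} (A : Finset (Fin n)) : List Bool :=
  List.ofFn fun a : Fin n => decide (a ∈ A)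

/-- The binary encoding of an instance: `1^n 0`, then the rows of the matrix `φ`, the
characteristic words of `S` and `T`, the sign bit of `k`, and the binary digits of `|k|`
(least significant first, without superfluous zeros). -/
def Instance.encode (I : Instance) : List Bool :=
  List.replicate I.n true ++ false :: ((List.ofFn fun a => List.ofFn (I.φ a)).flatten ++
    (charWord I.S ++ (charWord I.T ++ decide (I.k < 0) :: I.k.natAbs.bits)))

theorem charWord_injective {n : ℕ} : Function.Injective (charWord (n := n)) := by
  intro A B h
  have h' := List.ofFn_injective h
  ext a
  simpa using congrFun h' a

/-- An instance is determined by its encoding. -/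
theorem Instance.encode_injective : Function.Injective Instance.encode := by
  rintro ⟨n, φ, S, T, k, h1, h2, h3⟩ ⟨n', φ', S', T', k', h1', h2', h3'⟩ h
  simp only [Instance.encode] at h
  have hn : n = n' := by
    have := congrArg (fun l => (l.takeWhile id).length) h
    simpa [List.takeWhile_append, List.takeWhile_replicate] using this
  subst hn
  have h := List.append_cancel_left h
  simp only [List.cons.injEq, true_and] at h
  obtain ⟨ha, h⟩ := List.append_inj h
    (by simp [List.length_flatten, Function.comp_def, List.map_ofFn])
  obtain ⟨hS, h⟩ := List.append_inj h (by simp [charWord])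
  obtain ⟨hT, h⟩ := List.append_inj h (by simp [charWord])
  simp only [List.cons.injEq] at h
  obtain ⟨hk, hb⟩ := h
  obtain rfl := charWord_injective hS
  obtain rfl := charWord_injective hT
  have hφ : φ = φ' := by
    have hrows : (List.ofFn fun a => List.ofFn (φ a)) = List.ofFn fun a => List.ofFn (φ' a) := by
      rw [List.eq_iff_flatten_eq]
      exact ⟨ha, by simp [List.map_ofFn, Function.comp_def]⟩
    have hrows' := List.ofFn_injective hrows
    funext a
    exact List.ofFn_injective (congrFun hrows' a)
  subst hφ
  have habs : k.natAbs = k'.natAbs :=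
    Nat.eq_of_testBit_eq fun i => by rw [Nat.testBit_eq_inth, Nat.testBit_eq_inth, hb]
  have hkk : k = k' := by
    simp only [decide_eq_decide] at hk
    omega
  subst hkk
  rfl

/-- The problem GCAI for the rule `f`, parameterized by the number `ℓ = |S|` of distinguished
individuals. -/
def GCAI (f : AggregationRule) : ParamProblem :=
  {w | ∃ I : Instance, w = (I.encode, I.S.card) ∧ I.IsYes f}

end GroupIdentification

/-!
Control by adding individuals for the liberal-start-respecting rule is a node-weighted directed
Steiner tree problem: selection spreads along the arcs of the profile, starting from the individuals
who qualify themselves, so some `U` works if and only if a tree that leads from an additional root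
through `T ∪ U` reaches all of `S`. It is solved by inclusion and exclusion over the subsets of `S`.

Trees are relaxed to *branchings*, ordered trees whose labels may repeat (`Branching.labels`).
Relaxing changes nothing, since a branching still certifies that its labels are reached
(`mem_liberal_of_mem_labels`), while the selected individuals, each used once, are the labels of a
branching (`exists_labels_liberal`). As the root has a loop, branchings can be padded to exactly
`p = n + 1` nodes. So the instance is a yes-instance if and only if some branching with `p` nodes
contains all of `S` and has at most `k` labels outside `T` (`Instance.isYes_LSR_iff`).

In contrast to trees, branchings that avoid a given set `X` are easy to count, by a convolution
recursion over the number of nodes (`Branching.weightSum_succ`). Each branching is weighted by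
`B ^ i`, where `i` is the number of its labels in `T` or at the root. The alternating sum over
`X ⊆ S` then leaves the branchings through all of `S` (`Branching.sum_powerset_weightSum`). The
number `B = (4 p)^p` exceeds the number of all branchings, because Catalan numbers are at most
powers of `4`, so comparing that sum with `B ^ (p - k)` tells whether some branching has at most `k`
labels outside `T` (`Branching.odd_sum_add_pow_le_iff`).

The program runs through the codes `0, …, 2 ^ ℓ - 1` of the subsets of `S`
(`Branching.sum_range_two_pow_decode`) and fills for each of them a table of polynomial size. All
numbers stay below a bound `H` with `log H` polynomial in `|x|`. Hence a run is described by a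
number of steps, each of cost at most `len H ^ 2` (`RAM.Runs`), and loops are handled by the invariant
rule `RAM.Runs.down`. The parameter `κ` of an arbitrary input is unrelated to `x` and may be huge;
it is cut down to `|x| + 1` beforehand, and the codes are enumerated only after `κ = |S|` has been
checked.
-/

/-! ### Running random access machines -/

namespace RAM

@[simp] theorem State.setReg_reg (s : State) (d v : ℕ) :
    (s.setReg d v).reg = Function.update s.reg d v := rfl

@[simp] theorem State.setReg_mem (s : State) (d v : ℕ) : (s.setReg d v).mem = s.mem := rfl

@[simp] theorem State.setMem_reg (s : State) (a v : ℕ) : (s.setMem a v).reg = s.reg := rfl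

@[simp] theorem State.setMem_mem (s : State) (a v : ℕ) :
    (s.setMem a v).mem = Function.update s.mem a v := rfl

/-- All registers and memory cells hold numbers that are at most `H`. -/
def State.Bdd (H : ℕ) (s : State) : Prop :=
  (∀ i, s.reg i ≤ H) ∧ ∀ a, s.mem a ≤ H

theorem State.Bdd.setReg {H : ℕ} {s : State} (hs : s.Bdd H) {d v : ℕ} (hv : v ≤ H) :
    (s.setReg d v).Bdd H := by
  refine ⟨fun i => ?_, hs.2⟩
  rw [State.setReg_reg, Function.update_apply]
  split_ifs
  exacts [hv, hs.1 i]

theorem State.Bdd.setMem {H : ℕ} {s : State} (hs : s.Bdd H) {a v : ℕ} (hv : v ≤ H) :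
    (s.setMem a v).Bdd H := by
  refine ⟨hs.1, fun i => ?_⟩
  rw [State.setMem_mem, Function.update_apply]
  split_ifs
  exacts [hv, hs.2 i]

theorem len_mono {a b : ℕ} (h : a ≤ b) : len a ≤ len b :=
  Nat.succ_le_succ (Nat.size_le_size h)

namespace Prog

/-- Sequential composition of a list of programs. -/
def block : List Prog → Prog
  | [] => skip
  | p :: l => seq p (block l)

/-- The effect of a program without loops (loops are ignored). -/
def eval : Prog → State → State
  | skip, s => s
  | const d c, s => s.setReg d c
  | copy d a, s => s.setReg d (s.reg a)
  | add d a b, s => s.setReg d (s.reg a + s.reg b)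
  | sub d a b, s => s.setReg d (s.reg a - s.reg b)
  | mul d a b, s => s.setReg d (s.reg a * s.reg b)
  | div d a b, s => s.setReg d (s.reg a / s.reg b)
  | load d a, s => s.setReg d (s.mem (s.reg a))
  | store a b, s => s.setMem (s.reg a) (s.reg b)
  | seq p q, s => q.eval (p.eval s)
  | branch a p q, s => if s.reg a ≠ 0 then p.eval s else q.eval s
  | loop _ _, s => s

/-- The program has no loops, and started in `s` it only computes numbers that are at most `H`. -/
def Safe (H : ℕ) : Prog → State → Prop
  | const _ c, _ => c ≤ H
  | add _ a b, s => s.reg a + s.reg b ≤ H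
  | mul _ a b, s => s.reg a * s.reg b ≤ H
  | seq p q, s => p.Safe H s ∧ q.Safe H (p.eval s)
  | branch a p q, s => if s.reg a ≠ 0 then p.Safe H s else q.Safe H s
  | loop _ _, _ => False
  | _, _ => True

/-- A bound for the cost of a program without loops, in units of `len H ^ 2`, where `H` bounds all
numbers in the run: a basic instruction handles at most two of them. -/
def size : Prog → ℕ
  | seq p q => p.size + q.size
  | branch _ p q => 1 + p.size + q.size
  | loop _ p => 1 + p.size
  | _ => 2

/-- The registers that a program may write. -/
def writes : Prog → List ℕ
  | const d _ => [d]
  | copy d _ => [d]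
  | add d _ _ => [d]
  | sub d _ _ => [d]
  | mul d _ _ => [d]
  | div d _ _ => [d]
  | load d _ => [d]
  | seq p q => p.writes ++ q.writes
  | branch _ p q => p.writes ++ q.writes
  | loop _ p => p.writes
  | _ => []

/-- The program contains no `store` instruction. -/
def noStore : Prog → Bool
  | store _ _ => false
  | seq p q => p.noStore && q.noStore
  | branch _ p q => p.noStore && q.noStore
  | loop _ p => p.noStore
  | _ => true

/-- `down c p`: the body `p` is executed with `R[c] = v - 1, …, 1, 0`, where `v` is the number in
register `c` at the start. Register `2` is set to `1` before each pass. -/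
def down (c : ℕ) (p : Prog) : Prog :=
  loop c (seq (seq (const 2 1) (sub c c 2)) p)

end Prog

open Prog

/-- The registers that a program does not write keep their contents. -/
theorem Exec.reg_eq {p : Prog} {s t : State} {c : ℕ} (h : Exec p s t c) :
    ∀ r, r ∉ p.writes → t.reg r = s.reg r := by
  induction h with
  | skip | loop_done | store => intro r _; rfl
  | seq _ _ ihp ihq =>
    intro r hr
    simp only [writes, List.mem_append, not_or] at hr
    rw [ihq r hr.2, ihp r hr.1]
  | branch_true _ _ ih | branch_false _ _ ih =>
    intro r hr
    simp only [writes, List.mem_append, not_or] at hr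
    exact ih r (by tauto)
  | loop_step _ _ _ ihp ihl =>
    intro r hr
    rw [ihl r hr, ihp r hr]
  | _ =>
    intro r hr
    simp only [writes, List.mem_singleton] at hr
    exact Function.update_of_ne hr _ _

theorem Exec.mem_eq {p : Prog} {s t : State} {c : ℕ} (h : Exec p s t c) :
    p.noStore = true → t.mem = s.mem := by
  induction h with
  | seq _ _ ihp ihq =>
    intro hp
    simp only [noStore, Bool.and_eq_true] at hp
    rw [ihq hp.2, ihp hp.1]
  | branch_true _ _ ih | branch_false _ _ ih =>
    intro hp
    simp only [noStore, Bool.and_eq_true] at hp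
    exact ih (by tauto)
  | loop_step _ _ _ ihp ihl =>
    intro hp
    rw [ihl hp, ihp hp]
  | store => simp [noStore]
  | _ => intro _; rfl

/-- `Runs H k p s Q`: started in `s`, the program `p` halts within cost `k * len H ^ 2`, in a
configuration that satisfies `Q` and holds no numbers beyond `H`. So `k` counts steps, each of which
handles numbers up to `H`. -/
def Runs (H k : ℕ) (p : Prog) (s : State) (Q : State → Prop) : Prop :=
  ∃ t c, Exec p s t c ∧ c ≤ k * len H ^ 2 ∧ t.Bdd H ∧ Q t

theorem Runs.mono {H k k' : ℕ} {p : Prog} {s : State} {Q Q' : State → Prop}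
    (h : Runs H k p s Q) (hk : k ≤ k') (hQ : ∀ t, t.Bdd H → Q t → Q' t) : Runs H k' p s Q' := by
  obtain ⟨t, c, he, hc, ht, hq⟩ := h
  exact ⟨t, c, he, hc.trans (Nat.mul_le_mul_right _ hk), ht, hQ t ht hq⟩

theorem Runs.seq {H k k' : ℕ} {p q : Prog} {s : State} {R Q : State → Prop}
    (hp : Runs H k p s R) (hq : ∀ t, t.Bdd H → R t → Runs H k' q t Q) :
    Runs H (k + k') (.seq p q) s Q := by
  obtain ⟨t, c, he, hc, ht, hR⟩ := hp
  obtain ⟨t', c', he', hc', ht', hQ⟩ := hq t ht hR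
  exact ⟨t', c + c', .seq he he', by rw [Nat.add_mul]; omega, ht', hQ⟩

/-- What a program leaves alone may be added to every postcondition. -/
theorem Runs.frame {H k : ℕ} {p : Prog} {s : State} {Q : State → Prop} (h : Runs H k p s Q) :
    Runs H k p s fun t => Q t ∧ (∀ r, r ∉ p.writes → t.reg r = s.reg r) ∧
      (p.noStore = true → t.mem = s.mem) := by
  obtain ⟨t, c, he, hc, ht, hQ⟩ := h
  exact ⟨t, c, he, hc, ht, hQ, he.reg_eq, he.mem_eq⟩

theorem len_le_sq {H v : ℕ} (h : v ≤ H) : len v ≤ len H ^ 2 :=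
  (len_mono h).trans (Nat.le_self_pow two_ne_zero _)

theorem Runs.skip {H k : ℕ} {s : State} {Q : State → Prop} (hs : s.Bdd H) (hQ : Q s) (hk : 1 ≤ k) :
    Runs H k .skip s Q :=
  ⟨s, 1, .skip s, (len_le_sq (Nat.zero_le H)).trans (Nat.le_mul_of_pos_left _ hk), hs, hQ⟩

/-- Programs without loops run as `eval` says. -/
theorem Runs.straight {H : ℕ} {p : Prog} {s : State} (hs : s.Bdd H) (h : p.Safe H s) :
    Runs H p.size p s fun t => t = p.eval s := by
  have two : ∀ {a b}, a ≤ H → b ≤ H → len a + len b ≤ 2 * len H ^ 2 := fun ha hb => by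
    have := len_le_sq ha
    have := len_le_sq hb
    omega
  have sq : ∀ {a b}, a ≤ H → b ≤ H → len a * len b ≤ 2 * len H ^ 2 := fun ha hb =>
    (Nat.mul_le_mul (len_mono ha) (len_mono hb)).trans (by nlinarith)
  have one : ∀ {a}, a ≤ H → len a ≤ 2 * len H ^ 2 := fun ha => by
    have := len_le_sq ha
    omega
  induction p generalizing s with
  | skip => exact .skip hs rfl (by simp [size])
  | const d c => exact ⟨_, _, .const s d c, one h, hs.setReg h, rfl⟩
  | copy d a => exact ⟨_, _, .copy s d a, one (hs.1 a), hs.setReg (hs.1 a), rfl⟩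
  | add d a b => exact ⟨_, _, .add s d a b, two (hs.1 a) (hs.1 b), hs.setReg h, rfl⟩
  | sub d a b =>
    exact ⟨_, _, .sub s d a b, two (hs.1 a) (hs.1 b),
      hs.setReg ((Nat.sub_le _ _).trans (hs.1 a)), rfl⟩
  | mul d a b => exact ⟨_, _, .mul s d a b, sq (hs.1 a) (hs.1 b), hs.setReg h, rfl⟩
  | div d a b =>
    exact ⟨_, _, .div s d a b, sq (hs.1 a) (hs.1 b),
      hs.setReg ((Nat.div_le_self _ _).trans (hs.1 a)), rfl⟩
  | load d a => exact ⟨_, _, .load s d a, two (hs.1 a) (hs.2 _), hs.setReg (hs.2 _), rfl⟩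
  | store a b => exact ⟨_, _, .store s a b, two (hs.1 a) (hs.1 b), hs.setMem (hs.1 b), rfl⟩
  | seq p q ihp ihq =>
    refine Runs.seq (ihp hs h.1) ?_
    rintro t ht rfl
    exact ihq ht h.2
  | branch a p q ihp ihq =>
    simp only [Safe] at h
    have hl := len_le_sq (hs.1 a)
    by_cases ha : s.reg a = 0
    · rw [if_neg (not_not.2 ha)] at h
      obtain ⟨t, c, he, hc, ht, hQ⟩ := ihq hs h
      refine ⟨t, _, .branch_false ha he, ?_, ht, by simpa [eval, ha] using hQ⟩
      simp only [size, Nat.add_mul]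
      omega
    · rw [if_pos ha] at h
      obtain ⟨t, c, he, hc, ht, hQ⟩ := ihp hs h
      refine ⟨t, _, .branch_true ha he, ?_, ht, by simpa [eval, ha] using hQ⟩
      simp only [size, Nat.add_mul]
      omega
  | loop a p => exact h.elim

theorem Runs.branch {H k : ℕ} {a : ℕ} {p q : Prog} {s : State} {Q : State → Prop} (hs : s.Bdd H)
    (hp : s.reg a ≠ 0 → Runs H k p s Q) (hq : s.reg a = 0 → Runs H k q s Q) :
    Runs H (k + 1) (.branch a p q) s Q := by
  have hl := len_le_sq (hs.1 a)
  by_cases ha : s.reg a = 0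
  · obtain ⟨t, c, he, hc, ht, hQ⟩ := hq ha
    exact ⟨t, _, .branch_false ha he, by rw [Nat.add_mul]; omega, ht, hQ⟩
  · obtain ⟨t, c, he, hc, ht, hQ⟩ := hp ha
    exact ⟨t, _, .branch_true ha he, by rw [Nat.add_mul]; omega, ht, hQ⟩

/-- The invariant rule for `down` loops. The assertion `I k` holds whenever register `c` has come
down to `k`; it must not speak about the registers `c` and `2`. -/
theorem Runs.down {H K N c : ℕ} {p : Prog} {s : State} (I : ℕ → State → Prop)
    (hs : s.Bdd H) (hH : 1 ≤ H) (hc2 : c ≠ 2) (hcp : c ∉ p.writes) (hN : s.reg c ≤ N)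
    (hI : ∀ k t v w, I k t → I k ((t.setReg 2 v).setReg c w))
    (h0 : I (s.reg c) s)
    (hstep : ∀ k t, t.Bdd H → k < s.reg c → t.reg c = k → t.reg 2 = 1 →
      (∀ r, r ≠ c → r ≠ 2 → r ∉ p.writes → t.reg r = s.reg r) →
      (p.noStore = true → t.mem = s.mem) → I (k + 1) t → Runs H K p t (I k)) :
    Runs H (N * (K + 5) + 1) (down c p) s fun t => I 0 t ∧ t.reg c = 0 ∧
      (∀ r, r ≠ c → r ≠ 2 → r ∉ p.writes → t.reg r = s.reg r) ∧
      (p.noStore = true → t.mem = s.mem) := by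
  suffices main : ∀ n, n ≤ s.reg c → ∀ t, t.Bdd H → t.reg c = n → I n t →
      (∀ r, r ≠ c → r ≠ 2 → r ∉ p.writes → t.reg r = s.reg r) →
      (p.noStore = true → t.mem = s.mem) →
      Runs H (n * (K + 5) + 1) (Prog.down c p) t fun t => I 0 t ∧ t.reg c = 0 ∧
        (∀ r, r ≠ c → r ≠ 2 → r ∉ p.writes → t.reg r = s.reg r) ∧
        (p.noStore = true → t.mem = s.mem) from
    (main _ le_rfl s hs rfl h0 (fun _ _ _ _ => rfl) fun _ => rfl).mono
      (by gcongr) fun _ _ h => h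
  intro n
  induction n with
  | zero =>
    intro _ t ht hc hIt hr hm
    exact ⟨t, _, .loop_done hc, by
      rw [Nat.zero_mul, zero_add, one_mul]; exact len_le_sq (ht.1 c), ht, hIt, hc, hr, hm⟩
  | succ n ih =>
    intro hn t ht hc hIt hr hm
    have hcv : ((t.setReg 2 1).reg c - (t.setReg 2 1).reg 2) = n := by simp [hc2, hc]
    have hsafe : (Prog.seq (.const 2 1) (.sub c c 2)).Safe H t := ⟨hH, trivial⟩
    have hbody : Runs H (4 + K) (.seq (.seq (.const 2 1) (.sub c c 2)) p) t fun u =>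
        I n u ∧ u.Bdd H ∧ u.reg c = n ∧
        (∀ r, r ≠ c → r ≠ 2 → r ∉ p.writes → u.reg r = s.reg r) ∧
        (p.noStore = true → u.mem = s.mem) := by
      refine (Runs.straight ht hsafe).seq ?_
      rintro u hu rfl
      simp only [eval, hcv] at hu ⊢
      refine (hstep n _ hu (by omega) (by simp) (by simp [hc2.symm]) ?_ ?_
        (hI _ _ _ _ hIt)).frame.mono le_rfl ?_
      · intro r h1 h2 h3
        simpa [h1, h2] using hr r h1 h2 h3
      · simpa using hm
      · rintro v hv ⟨hIv, hrv, hmv⟩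
        refine ⟨hIv, hv, by simp [hrv c hcp], fun r h1 h2 h3 => ?_, fun h => ?_⟩
        · rw [hrv r h3]
          simpa [h1, h2] using hr r h1 h2 h3
        · rw [hmv h]
          simpa using hm h
    obtain ⟨u, d, he, hd, -, hIu, hu, hcu, hru, hmu⟩ := hbody
    obtain ⟨v, e, he', hd', hv, hQ⟩ := ih (by omega) u hu hcu hIu hru hmu
    refine ⟨v, _, .loop_step (by omega) he he', ?_, hv, hQ⟩
    have := len_le_sq (ht.1 c)
    calc len (t.reg c) + d + e
        ≤ len H ^ 2 + (4 + K) * len H ^ 2 + (n * (K + 5) + 1) * len H ^ 2 := by gcongr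
      _ = _ := by ring

end RAM

/-! ### Branchings and their generating sums -/

namespace Branching

open Finset

variable (p : ℕ) (E : ℕ → ℕ → Bool)

/-- The label multisets of the branchings with `j + 1` nodes and root `v`, in the digraph `E` on
`{0, …, p - 1}`: a branching with more than one node arises from two smaller ones, with roots `v`
and `u`, by making the second root the last child of the first, where `E v u` is an arc. Labels may
repeat, and a multiset is listed once for every branching with these labels. -/
def labels : ℕ → ℕ → Multiset (Multiset ℕ)
  | 0, v => {{v}}
  | j + 1, v => ∑ u ∈ (range p).filter fun u => E v u = true, ∑ i : Fin (j + 1),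
      (labels i v ×ˢ labels (j - i) u).map fun q => q.1 + q.2

/-- The sum, over all branchings with `j + 1` nodes and root `v`, of the product of the weights of
the labels. -/
def weightSum (w : ℕ → ℕ) (j v : ℕ) : ℕ :=
  ((labels p E j v).map fun α => (α.map w).prod).sum

variable {p E}

theorem mem_labels_zero {v : ℕ} {α : Multiset ℕ} : α ∈ labels p E 0 v ↔ α = {v} := by
  simp [labels]

theorem mem_labels_succ {j v : ℕ} {α : Multiset ℕ} :
    α ∈ labels p E (j + 1) v ↔ ∃ u < p, E v u = true ∧ ∃ i ≤ j, ∃ β ∈ labels p E i v,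
      ∃ γ ∈ labels p E (j - i) u, α = β + γ := by
  rw [labels]
  simp only [Multiset.mem_sum, mem_filter, mem_range, mem_univ, true_and, Multiset.mem_map,
    Multiset.mem_product, Prod.exists]
  constructor
  · rintro ⟨u, ⟨hu, he⟩, i, β, γ, ⟨hβ, hγ⟩, rfl⟩
    exact ⟨u, hu, he, i, Nat.lt_succ_iff.1 i.2, β, hβ, γ, hγ, rfl⟩
  · rintro ⟨u, hu, he, i, hi, β, hβ, γ, hγ, rfl⟩
    exact ⟨u, ⟨hu, he⟩, ⟨i, Nat.lt_succ_of_le hi⟩, β, γ, ⟨hβ, hγ⟩, rfl⟩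

@[simp] theorem weightSum_zero (w : ℕ → ℕ) (v : ℕ) : weightSum p E w 0 v = w v := by
  simp [weightSum, labels]

/-- A branching that is put together from two parts has the product of their weights. -/
theorem sum_map_product_add (A B : Multiset (Multiset ℕ)) (w : ℕ → ℕ) :
    (((A ×ˢ B).map fun q => q.1 + q.2).map fun α => (α.map w).prod).sum =
      (A.map fun α => (α.map w).prod).sum * (B.map fun α => (α.map w).prod).sum := by
  induction A using Multiset.induction_on with
  | empty => simp
  | cons a A ih =>
    simp only [Multiset.cons_product, Multiset.map_add, Multiset.sum_add, ih, Multiset.map_cons,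
      Multiset.sum_cons, add_mul]
    simp [Multiset.sum_map_mul_left]

theorem weightSum_succ (w : ℕ → ℕ) (j v : ℕ) :
    weightSum p E w (j + 1) v = ∑ u ∈ range p, if E v u = true then
      ∑ i ∈ range (j + 1), weightSum p E w i v * weightSum p E w (j - i) u else 0 := by
  rw [weightSum, labels, ← sum_filter]
  have hom : ∀ {ι : Type} (s : Finset ι) (f : ι → Multiset (Multiset ℕ)),
      ((∑ i ∈ s, f i).map fun α => (α.map w).prod).sum =
        ∑ i ∈ s, ((f i).map fun α => (α.map w).prod).sum := fun s f => by
    classical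
    induction s using Finset.induction_on with
    | empty => simp
    | insert a s ha ih => simp [sum_insert ha, ih]
  rw [hom]
  refine sum_congr rfl fun u _ => ?_
  rw [hom, ← Fin.sum_univ_eq_sum_range
    (fun i => weightSum p E w i v * weightSum p E w (j - i) u) (j + 1)]
  exact sum_congr rfl fun i _ => sum_map_product_add _ _ w

theorem card_of_mem_labels {j v : ℕ} {α : Multiset ℕ} (h : α ∈ labels p E j v) :
    α.card = j + 1 := by
  induction j using Nat.strong_induction_on generalizing v α with
  | _ j ih =>
    cases j with
    | zero => simp [mem_labels_zero.1 h]
    | succ j =>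
      obtain ⟨u, -, -, i, hi, β, hβ, γ, hγ, rfl⟩ := mem_labels_succ.1 h
      rw [Multiset.card_add, ih i (by omega) hβ, ih (j - i) (by omega) hγ]
      omega

theorem root_mem_labels {j v : ℕ} {α : Multiset ℕ} (h : α ∈ labels p E j v) : v ∈ α := by
  induction j using Nat.strong_induction_on generalizing α with
  | _ j ih =>
    cases j with
    | zero => simp [mem_labels_zero.1 h]
    | succ j =>
      obtain ⟨u, -, -, i, hi, β, hβ, γ, -, rfl⟩ := mem_labels_succ.1 h
      exact Multiset.mem_add.2 (.inl (ih i (by omega) hβ))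

theorem weightSum_one (j v : ℕ) : weightSum p E (fun _ => 1) j v = (labels p E j v).card := by
  simp [weightSum]

/-- Forgetting the labels leaves ordered trees, which the Catalan numbers count. -/
theorem card_labels_le_catalan (j v : ℕ) : (labels p E j v).card ≤ p ^ j * catalan j := by
  induction j using Nat.strong_induction_on generalizing v with
  | _ j ih =>
    cases j with
    | zero => simp [labels]
    | succ j =>
      rw [← weightSum_one, weightSum_succ]
      calc _ ≤ ∑ _u ∈ range p, p ^ j * catalan (j + 1) := ?_
        _ = _ := by simp [pow_succ]; ring
      refine sum_le_sum fun u _ => ?_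
      split_ifs
      · rw [catalan_succ, mul_sum, ← Fin.sum_univ_eq_sum_range
          (fun i => weightSum p E (fun _ => 1) i v * weightSum p E (fun _ => 1) (j - i) u)]
        refine sum_le_sum fun i _ => ?_
        have hi := i.2
        rw [weightSum_one, weightSum_one]
        calc _ ≤ (p ^ (i : ℕ) * catalan i) * (p ^ (j - i) * catalan (j - i)) :=
              Nat.mul_le_mul (ih i (by omega) v) (ih (j - i) (by omega) u)
          _ = p ^ (i + (j - i) : ℕ) * (catalan i * catalan (j - i)) := by rw [pow_add]; ring
          _ = _ := by congr 2; omega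
      · exact Nat.zero_le _

theorem card_labels_le (j v : ℕ) : (labels p E j v).card ≤ (4 * p) ^ j := by
  refine (card_labels_le_catalan j v).trans ?_
  rw [mul_pow, mul_comm]
  refine Nat.mul_le_mul_right _ ?_
  rw [catalan_eq_centralBinom_div]
  refine (Nat.div_le_self _ _).trans ?_
  rw [Nat.centralBinom, show 4 ^ j = 2 ^ (2 * j) by rw [pow_mul]; rfl]
  exact Nat.choose_le_two_pow _ _

theorem weightSum_le {w : ℕ → ℕ} {B : ℕ} (hw : ∀ v, w v ≤ B) (j v : ℕ) :
    weightSum p E w j v ≤ (4 * p) ^ j * B ^ (j + 1) := by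
  have h : ∀ x ∈ (labels p E j v).map fun α => (α.map w).prod, x ≤ B ^ (j + 1) := by
    intro x hx
    obtain ⟨α, hα, rfl⟩ := Multiset.mem_map.1 hx
    rw [← card_of_mem_labels hα, ← Multiset.card_map w α]
    refine Multiset.prod_le_pow_card _ _ fun y hy => ?_
    obtain ⟨a, -, rfl⟩ := Multiset.mem_map.1 hy
    exact hw a
  calc _ ≤ _ := Multiset.sum_le_card_nsmul _ _ h
    _ ≤ _ := by
      rw [Multiset.card_map, smul_eq_mul]
      exact Nat.mul_le_mul_right _ (card_labels_le j v)

/-- A new leaf can be attached at any node. -/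
theorem add_singleton_mem_labels {j v x y : ℕ} {α : Multiset ℕ} (h : α ∈ labels p E j v)
    (hx : x ∈ α) (hy : y < p) (he : E x y = true) : α + {y} ∈ labels p E (j + 1) v := by
  induction j using Nat.strong_induction_on generalizing v α with
  | _ j ih =>
    cases j with
    | zero =>
      obtain rfl := mem_labels_zero.1 h
      obtain rfl := Multiset.mem_singleton.1 hx
      exact mem_labels_succ.2 ⟨y, hy, he, 0, le_rfl, _, mem_labels_zero.2 rfl, _,
        mem_labels_zero.2 rfl, rfl⟩
    | succ j =>
      obtain ⟨u, hu, hvu, i, hi, β, hβ, γ, hγ, rfl⟩ := mem_labels_succ.1 h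
      rcases Multiset.mem_add.1 hx with hx | hx
      · exact mem_labels_succ.2 ⟨u, hu, hvu, i + 1, by omega, _, ih i (by omega) hβ hx, γ,
          by rwa [show j + 1 - (i + 1) = j - i by omega], by abel⟩
      · exact mem_labels_succ.2 ⟨u, hu, hvu, i, by omega, β, hβ, _,
          by rw [show j + 1 - i = j - i + 1 by omega]; exact ih (j - i) (by omega) hγ hx, by abel⟩

/-! ### Inclusion and exclusion -/

/-- The weights that exclude the branchings through `X` and otherwise charge `B` for each label
satisfying `q`. -/
def avoidWeight (q : ℕ → Bool) (B : ℕ) (X : Finset ℕ) (v : ℕ) : ℕ :=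
  if v ∈ X then 0 else if q v = true then B else 1

theorem avoidWeight_le {q : ℕ → Bool} {B : ℕ} (hB : 1 ≤ B) (X : Finset ℕ) (v : ℕ) :
    avoidWeight q B X v ≤ B := by
  unfold avoidWeight
  split_ifs <;> omega

theorem prod_avoidWeight (q : ℕ → Bool) (B : ℕ) (X : Finset ℕ) (α : Multiset ℕ) :
    (α.map (avoidWeight q B X)).prod =
      if ∃ x ∈ X, x ∈ α then 0 else B ^ α.countP fun a => q a = true := by
  induction α using Multiset.induction_on with
  | empty => simp
  | cons a α ih =>
    rw [Multiset.map_cons, Multiset.prod_cons, ih, Multiset.countP_cons]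
    clear ih
    by_cases ha : a ∈ X
    · rw [if_pos (⟨a, ha, Multiset.mem_cons_self _ _⟩ : ∃ x ∈ X, x ∈ a ::ₘ α), avoidWeight,
        if_pos ha, zero_mul]
    · have h : (∃ x ∈ X, x ∈ a ::ₘ α) ↔ ∃ x ∈ X, x ∈ α := by
        simp only [Multiset.mem_cons]
        constructor
        · rintro ⟨x, hx, rfl | h⟩
          exacts [absurd hx ha, ⟨x, hx, h⟩]
        · exact fun ⟨x, hx, h⟩ => ⟨x, hx, .inr h⟩
      simp only [h, avoidWeight, ha, if_false]
      split_ifs <;> simp [pow_succ, mul_comm]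

/-- The alternating sum over `X ⊆ S` of the weights of the branchings that avoid `X` is the sum of
the weights of the branchings that meet every element of `S`. -/
theorem sum_powerset_weightSum (q : ℕ → Bool) (B : ℕ) (S : Finset ℕ) (j v : ℕ) :
    ∑ X ∈ S.powerset, (-1 : ℤ) ^ X.card * weightSum p E (avoidWeight q B X) j v =
      (((labels p E j v).filter fun α => ∀ s ∈ S, s ∈ α).map
        fun α => B ^ α.countP fun a => q a = true).sum := by
  unfold weightSum
  induction labels p E j v using Multiset.induction_on with
  | empty => simp
  | cons α A ih =>
    simp only [Multiset.map_cons, Multiset.sum_cons, Nat.cast_add, mul_add, sum_add_distrib, ih]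
    simp only [prod_avoidWeight]
    have key : ∑ X ∈ S.powerset, (-1 : ℤ) ^ X.card *
        ((if ∃ x ∈ X, x ∈ α then 0 else B ^ α.countP fun a => q a = true : ℕ) : ℤ) =
        if ∀ s ∈ S, s ∈ α then (B : ℤ) ^ α.countP (fun a => q a = true) else 0 := by
      -- The sets `X ⊆ S` that `α` avoids are the subsets of `S \ α`, and their signs cancel
      -- unless `S \ α` is empty.
      have hf : S.powerset.filter (fun X => ¬ ∃ x ∈ X, x ∈ α) =
          (S.filter fun s => s ∉ α).powerset := by
        ext X
        simp only [mem_filter, mem_powerset, subset_iff]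
        constructor
        · rintro ⟨h1, h2⟩ x hx
          exact ⟨h1 hx, fun h => h2 ⟨x, hx, h⟩⟩
        · intro h
          exact ⟨fun x hx => (h hx).1, fun ⟨a, hX, ha⟩ => (h hX).2 ha⟩
      calc _ = ∑ X ∈ S.powerset with ¬ ∃ x ∈ X, x ∈ α,
            (-1 : ℤ) ^ X.card * (B : ℤ) ^ α.countP (fun a => q a = true) := by
            rw [sum_filter]
            refine sum_congr rfl fun X _ => ?_
            by_cases h : ∃ x ∈ X, x ∈ α
            · rw [if_pos h, if_neg (not_not.2 h)]; simp
            · rw [if_neg h, if_pos h]; push_cast; rfl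
        _ = _ := by
            rw [hf, ← sum_mul, sum_powerset_neg_one_pow_card]
            simp only [filter_eq_empty_iff, not_not]
            split_ifs <;> simp
    rw [key]
    by_cases h : ∀ s ∈ S, s ∈ α
    · rw [if_pos h, Multiset.filter_cons_of_pos _ h]
      simp
    · rw [if_neg h, Multiset.filter_cons_of_neg _ h, zero_add]

/-- If a sum of powers of `B` has fewer than `B` terms, its size tells the largest exponent. -/
theorem pow_le_sum_iff {ι : Type} {A : Multiset ι} {B : ℕ} (hA : A.card < B) (f : ι → ℕ) (e : ℕ) :
    B ^ e ≤ (A.map fun a => B ^ f a).sum ↔ ∃ a ∈ A, e ≤ f a := by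
  constructor
  · intro h
    by_contra! hlt
    -- Otherwise each of the fewer than `B` terms is at most `B ^ (e - 1)`; multiplying by `B`
    -- avoids the subtraction.
    have hle : (A.map fun a => B ^ f a).sum * B ≤ A.card * B ^ e := by
      rw [← Multiset.sum_map_mul_right]
      have : ∀ x ∈ A.map fun a => B ^ f a * B, x ≤ B ^ e := by
        intro x hx
        obtain ⟨a, ha, rfl⟩ := Multiset.mem_map.1 hx
        rw [← pow_succ]
        exact Nat.pow_le_pow_right (by omega) (hlt a ha)
      simpa using Multiset.sum_le_card_nsmul _ _ this
    have hpos : 0 < B ^ e := Nat.pow_pos (by omega)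
    nlinarith
  · rintro ⟨a, ha, he⟩
    exact (Nat.pow_le_pow_right (by omega) he).trans
      (Multiset.single_le_sum (fun _ _ => Nat.zero_le _) _ (Multiset.mem_map_of_mem _ ha))

/-- The test by inclusion and exclusion, without negative numbers: some branching meets all of `S`
and has at least `e` labels satisfying `q`, if and only if the sum over the even `X ⊆ S` exceeds the
sum over the odd ones by at least `B ^ e`. -/
theorem odd_sum_add_pow_le_iff (q : ℕ → Bool) (B : ℕ) (S : Finset ℕ) (j v e : ℕ)
    (hB : (4 * p) ^ j < B) :
    ((∑ X ∈ S.powerset with Odd X.card, weightSum p E (avoidWeight q B X) j v) + B ^ e ≤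
      ∑ X ∈ S.powerset with ¬ Odd X.card, weightSum p E (avoidWeight q B X) j v) ↔
      ∃ α ∈ labels p E j v, (∀ s ∈ S, s ∈ α) ∧ e ≤ α.countP fun a => q a = true := by
  have h := sum_powerset_weightSum (p := p) (E := E) q B S j v
  rw [← sum_filter_add_sum_filter_not _ (fun X : Finset ℕ => Odd X.card)] at h
  have hodd : ∑ X ∈ S.powerset with Odd X.card,
      (-1 : ℤ) ^ X.card * (weightSum p E (avoidWeight q B X) j v : ℤ) =
      -((∑ X ∈ S.powerset with Odd X.card, weightSum p E (avoidWeight q B X) j v : ℕ) : ℤ) := by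
    push_cast
    rw [← sum_neg_distrib]
    refine sum_congr rfl fun X hX => ?_
    rw [(mem_filter.1 hX).2.neg_one_pow]
    ring
  have heven : ∑ X ∈ S.powerset with ¬ Odd X.card,
      (-1 : ℤ) ^ X.card * (weightSum p E (avoidWeight q B X) j v : ℤ) =
      ((∑ X ∈ S.powerset with ¬ Odd X.card, weightSum p E (avoidWeight q B X) j v : ℕ) : ℤ) := by
    push_cast
    refine sum_congr rfl fun X hX => ?_
    rw [(Nat.not_odd_iff_even.1 (mem_filter.1 hX).2).neg_one_pow]
    ring
  rw [hodd, heven] at h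
  have hcard : (Multiset.filter (fun α => ∀ s ∈ S, s ∈ α) (labels p E j v)).card < B :=
    ((Multiset.card_le_card (Multiset.filter_le _ _)).trans (card_labels_le j v)).trans_lt hB
  have h2 := pow_le_sum_iff hcard (fun α => α.countP fun a => q a = true) e
  simp only [Multiset.mem_filter, and_assoc] at h2
  rw [← h2]
  omega

/-! ### Enumerating the subsets -/

/-- The subset of `{v < k | S v}` with code `c`: the binary digits of `c`, beginning with the least
significant one, belong to the elements in decreasing order. -/
def decode (S : ℕ → Bool) : ℕ → ℕ → Finset ℕ
  | 0, _ => ∅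
  | k + 1, c => if S k = true then
      (if c % 2 = 1 then insert k (decode S k (c / 2)) else decode S k (c / 2))
    else decode S k c

theorem lt_of_mem_decode {S : ℕ → Bool} {k c v : ℕ} (h : v ∈ decode S k c) : v < k := by
  induction k generalizing c with
  | zero => simp [decode] at h
  | succ k ih =>
    rw [decode] at h
    split_ifs at h
    · rcases mem_insert.1 h with rfl | h
      exacts [Nat.lt_succ_self _, (ih h).trans (Nat.lt_succ_self _)]
    all_goals exact (ih h).trans (Nat.lt_succ_self _)

/-- Each subset of `{v < k | S v}` has exactly one code. -/
theorem sum_range_two_pow_decode {M : Type} [AddCommMonoid M] (S : ℕ → Bool) (k : ℕ)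
    (g : Finset ℕ → M) :
    ∑ c ∈ range (2 ^ ((range k).filter fun v => S v = true).card), g (decode S k c) =
      ∑ X ∈ ((range k).filter fun v => S v = true).powerset, g X := by
  induction k generalizing g with
  | zero => simp [decode]
  | succ k ih =>
    have hk : k ∉ (range k).filter fun v => S v = true := by simp
    by_cases hS : S k = true
    · have hr : (range (k + 1)).filter (fun v => S v = true) =
          insert k ((range k).filter fun v => S v = true) := by
        rw [range_add_one, filter_insert, if_pos hS]
      have two : ∀ (m : ℕ) (f : ℕ → M),
          ∑ c ∈ range (m * 2), f c = ∑ c ∈ range m, (f (2 * c) + f (2 * c + 1)) := by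
        intro m f
        induction m with
        | zero => simp
        | succ m ihm => rw [sum_range_succ, ← ihm, Nat.succ_mul, sum_range_succ, sum_range_succ,
            add_assoc, mul_comm m 2]
      rw [hr, card_insert_of_notMem hk, sum_powerset_insert hk, pow_succ, two, sum_add_distrib,
        ← ih g, ← ih fun X => g (insert k X)]
      congr 1
      · refine sum_congr rfl fun c _ => ?_
        rw [decode, if_pos hS, if_neg (by omega), Nat.mul_div_cancel_left _ two_pos]
      · refine sum_congr rfl fun c _ => ?_
        rw [decode, if_pos hS, if_pos (by omega), show (2 * c + 1) / 2 = c by omega]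
    · rw [range_add_one, filter_insert, if_neg hS, ← ih g]
      exact sum_congr rfl fun c _ => by rw [decode, if_neg hS]

end Branching

/-! ### Reading encoded instances -/

namespace GroupIdentification

open Finset

/-- The letter at position `a` of the word `x` (and `false` behind its end). -/
def bit (x : List Bool) (a : ℕ) : Bool := x.getD a false

/-- Where the characteristic word of `S` begins in the encoding of an instance with `n`
individuals. -/
def posS (n : ℕ) : ℕ := n * n + (n + 1)

/-- Where the characteristic word of `T` begins. -/
def posT (n : ℕ) : ℕ := posS n + n

/-- The position of the sign of `k`. -/
def posSign (n : ℕ) : ℕ := posT n + n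

/-- Where the binary digits of `k` begin. -/
def posK (n : ℕ) : ℕ := posSign n + 1

theorem drop_eq_ofFn_append {x : List Bool} {s l : ℕ} (h : s + l ≤ x.length) :
    x.drop s = List.ofFn (fun i : Fin l => bit x (s + i)) ++ x.drop (s + l) := by
  rw [← List.drop_drop]
  conv_lhs => rw [← List.take_append_drop l (x.drop s)]
  congr 1
  refine List.ext_getElem (by simp; omega) fun i h1 h2 => ?_
  have hi : s + i < x.length := by simp at h1; omega
  simp [bit, hi]

theorem Instance.posK_le_length (I : Instance) : posK I.n ≤ I.encode.length := by
  simp only [Instance.encode, charWord, posK, posSign, posT, posS, List.length_append,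
    List.length_replicate, List.length_cons, List.length_flatten, List.map_ofFn,
    Function.comp_def, List.length_ofFn, List.ofFn_const, List.sum_replicate, smul_eq_mul]
  omega

/-- An instance is encoded by `x` if the parts of `x` are what they should be. -/
theorem Instance.encode_eq_iff {I : Instance} {x : List Bool} (hx : posK I.n ≤ x.length) :
    I.encode = x ↔ (∀ i < I.n, bit x i = true) ∧ bit x I.n = false ∧
      (∀ a b : Fin I.n, I.φ a b = bit x (I.n + 1 + (a * I.n + b))) ∧
      (∀ a : Fin I.n, decide (a ∈ I.S) = bit x (posS I.n + a)) ∧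
      (∀ a : Fin I.n, decide (a ∈ I.T) = bit x (posT I.n + a)) ∧
      decide (I.k < 0) = bit x (posSign I.n) ∧ I.k.natAbs.bits = x.drop (posK I.n) := by
  obtain ⟨n, φ, S, T, k, h1, h2, h3⟩ := I
  simp only at hx ⊢
  have e : x = List.ofFn (fun i : Fin n => bit x i) ++ (bit x n ::
      (List.ofFn (fun i : Fin (n * n) => bit x (n + 1 + i)) ++
      (List.ofFn (fun i : Fin n => bit x (posS n + i)) ++
      (List.ofFn (fun i : Fin n => bit x (posT n + i)) ++
      (bit x (posSign n) :: x.drop (posK n)))))) := by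
    simp only [posK, posSign, posT, posS] at hx ⊢
    conv_lhs =>
      rw [← List.drop_zero (l := x), drop_eq_ofFn_append (l := n) (by omega),
        drop_eq_ofFn_append (s := 0 + n) (l := 1) (by omega),
        drop_eq_ofFn_append (s := 0 + n + 1) (l := n * n) (by omega),
        drop_eq_ofFn_append (s := 0 + n + 1 + n * n) (l := n) (by omega),
        drop_eq_ofFn_append (s := 0 + n + 1 + n * n + n) (l := n) (by omega),
        drop_eq_ofFn_append (s := 0 + n + 1 + n * n + n + n) (l := 1) (by omega)]
    simp [List.ofFn_succ, zero_add, show n + 1 + n * n = n * n + (n + 1) by omega]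
  have hmat : ((List.ofFn fun a => List.ofFn (φ a)).flatten =
      List.ofFn fun i : Fin (n * n) => bit x (n + 1 + i)) ↔
      ∀ a b : Fin n, φ a b = bit x (n + 1 + (a * n + b)) := by
    rw [List.ofFn_mul]
    constructor
    · intro h a b
      have hrows : (List.ofFn fun a => List.ofFn (φ a)) = List.ofFn fun a : Fin n =>
          List.ofFn fun b : Fin n => bit x (n + 1 + (a * n + b)) := by
        rw [List.eq_iff_flatten_eq]
        exact ⟨h, by simp [List.map_ofFn, Function.comp_def]⟩
      exact congrFun (List.ofFn_injective (congrFun (List.ofFn_injective hrows) a)) b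
    · intro h
      have h' : ∀ a, φ a = fun b : Fin n => bit x (n + 1 + (a * n + b)) := fun a => funext (h a)
      simp only [h']
  have hchar : ∀ (A : Finset (Fin n)) (s : ℕ),
      charWord A = List.ofFn (fun i : Fin n => bit x (s + i)) ↔
      ∀ a : Fin n, decide (a ∈ A) = bit x (s + a) := fun A s => by
    rw [charWord, List.ofFn_injective.eq_iff, funext_iff]
  have hrep : List.replicate n true = List.ofFn (fun i : Fin n => bit x i) ↔
      ∀ i < n, bit x i = true := by
    rw [← List.ofFn_const, List.ofFn_injective.eq_iff, funext_iff]
    exact ⟨fun h i hi => (h ⟨i, hi⟩).symm, fun h i => (h i i.2).symm⟩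
  rw [← hrep, ← hmat, ← hchar S, ← hchar T]
  conv_lhs => rw [e]
  simp only [Instance.encode]
  constructor
  · intro h
    obtain ⟨a1, h⟩ := List.append_inj h (by simp)
    obtain ⟨a2, h⟩ := List.cons.inj h
    obtain ⟨a3, h⟩ := List.append_inj h
      (by simp [List.length_flatten, Function.comp_def, List.map_ofFn])
    obtain ⟨a4, h⟩ := List.append_inj h (by simp [charWord])
    obtain ⟨a5, h⟩ := List.append_inj h (by simp [charWord])
    obtain ⟨a6, h⟩ := List.cons.inj h
    exact ⟨a1, a2.symm, a3, a4, a5, a6, h⟩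
  · rintro ⟨a1, a2, a3, a4, a5, a6, a7⟩
    rw [a1, a2, a3, a4, a5, a6, a7]

/-- The number with the binary digits `l`, least significant first. -/
def wordVal (l : List Bool) : ℕ := l.foldr (fun b v => 2 * v + b.toNat) 0

theorem wordVal_cons (b : Bool) (l : List Bool) : wordVal (b :: l) = Nat.bit b (wordVal l) := by
  cases b <;> simp [wordVal, Nat.bit_val]

theorem wordVal_bits (m : ℕ) : wordVal m.bits = m := by
  induction m using Nat.binaryRec' with
  | zero => simp [wordVal]
  | bit b m h ih => rw [Nat.bits_append_bit _ _ h, wordVal_cons, ih]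

theorem bits_wordVal {l : List Bool} (h : l.getLast? ≠ some false) : (wordVal l).bits = l := by
  induction l with
  | nil => simp [wordVal]
  | cons b l ih =>
    have hl : l.getLast? ≠ some false := by
      cases l with
      | nil => simp
      | cons a l => rwa [List.getLast?_cons_cons] at h
    rw [wordVal_cons, Nat.bits_append_bit, ih hl]
    intro h0
    obtain rfl : l = [] := by rw [← ih hl, h0, Nat.zero_bits]
    simpa using h

theorem getLast?_bits (m : ℕ) : m.bits.getLast? ≠ some false := by
  induction m using Nat.binaryRec' with
  | zero => simp
  | bit b m h ih =>
    rw [Nat.bits_append_bit _ _ h]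
    cases hm : m.bits with
    | nil =>
      have := wordVal_bits m
      rw [hm] at this
      simp [h this.symm]
    | cons a l => rwa [List.getLast?_cons_cons, ← hm]

theorem wordVal_lt (l : List Bool) : wordVal l < 2 ^ l.length := by
  induction l with
  | nil => simp [wordVal]
  | cons b l ih =>
    rw [wordVal_cons, Nat.bit_val, List.length_cons, pow_succ]
    have := Bool.toNat_le b
    omega

theorem getLast?_drop_ne_iff (x : List Bool) (s : ℕ) :
    (x.drop s).getLast? ≠ some false ↔ (s < x.length → bit x (x.length - 1) = true) := by
  rw [List.getLast?_drop]
  split_ifs with h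
  · simp [Nat.not_lt.2 h]
  · have hx : x.length - 1 < x.length := by omega
    simp [List.getLast?_eq_getElem?, bit, hx, not_le.1 h]

/-- The distinguished individuals, as read off the word `x`. -/
def wordS (x : List Bool) (n : ℕ) : Finset ℕ := (range n).filter fun v => bit x (posS n + v) = true

/-- The word `x`, which begins with `1^n 0`, encodes an instance with `k ≥ 0` and parameter `κ`. -/
structure ValidWord (x : List Bool) (κ n : ℕ) : Prop where
  length : posK n ≤ x.length
  sign : bit x (posSign n) = false
  sub : ∀ v < n, bit x (posS n + v) = true → bit x (posT n + v) = true
  card : (wordS x n).card = κ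
  pos : 1 ≤ κ
  last : posK n < x.length → bit x (x.length - 1) = true

/-- The arcs along which qualification spreads: those of the profile, and from an additional vertex
`n`, the root, to all individuals who qualify themselves. The loop at the root allows branchings to
be extended at no cost. -/
def arc (x : List Bool) (n v u : ℕ) : Bool :=
  if u = n then decide (v = n)
  else if v = n then bit x (n + 1 + (u * n + u)) else bit x (n + 1 + (v * n + u))

/-- The vertices which need not be added: the root and the members of `T`. -/
def inside (x : List Bool) (n v : ℕ) : Bool :=
  if v = n then true else bit x (posT n + v)

end GroupIdentification

/-! ### Control by adding individuals in terms of branchings -/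

namespace GroupIdentification

open Finset Branching

section Liberal

variable {N : Type} [DecidableEq N] {φ : Profile N} {A : Finset N}

theorem mem_liberal {a : N} : a ∈ liberal φ A ↔ a ∈ A ∧ ∃ i, a ∈ liberalStage φ A i := by
  simp [liberal]

theorem mem_liberal_of_self {a : N} (ha : a ∈ A) (h : φ a a = true) : a ∈ liberal φ A :=
  mem_liberal.2 ⟨ha, 0, mem_filter.2 ⟨ha, h⟩⟩

theorem mem_liberal_of_mem {a b : N} (ha : a ∈ A) (hb : b ∈ liberal φ A) (h : φ b a = true) :
    a ∈ liberal φ A := by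
  obtain ⟨-, i, hi⟩ := mem_liberal.1 hb
  exact mem_liberal.2 ⟨ha, i + 1, mem_union_right _ (mem_filter.2 ⟨ha, b, hi, h⟩)⟩

/-- A proper subset of the selected set misses an individual who qualifies himself or is qualified
by a member of the subset. -/
theorem exists_mem_liberal_notMem {D : Finset N} (hD : D ⊂ liberal φ A) :
    ∃ a ∈ liberal φ A, a ∉ D ∧ (φ a a = true ∨ ∃ b ∈ D, φ b a = true) := by
  classical
  obtain ⟨a₀, ha₀, hna₀⟩ := exists_of_ssubset hD
  have hex : ∃ i, ∃ a ∈ liberalStage φ A i, a ∉ D := by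
    obtain ⟨-, i, hi⟩ := mem_liberal.1 ha₀
    exact ⟨i, a₀, hi, hna₀⟩
  obtain ⟨a, ha, hna⟩ := Nat.find_spec hex
  refine ⟨a, mem_liberal.2 ⟨liberalStage_subset φ A _ ha, _, ha⟩, hna, ?_⟩
  cases hi : Nat.find hex with
  | zero =>
    rw [hi] at ha
    exact .inl (mem_filter.1 ha).2
  | succ i =>
    have hmin : ∀ b ∈ liberalStage φ A i, b ∈ D := fun b hb => by
      by_contra hbD
      exact Nat.find_min hex (m := i) (by omega) ⟨b, hb, hbD⟩
    rw [hi] at ha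
    rcases mem_union.1 ha with ha | ha
    · exact absurd (hmin a ha) hna
    · obtain ⟨-, b, hb, hba⟩ := mem_filter.1 ha
      exact .inr ⟨b, hmin b hb, hba⟩

end Liberal

/-- In a branching whose labels belong to `A`, selection spreads from the root to all nodes. -/
theorem mem_liberal_of_mem_labels {n : ℕ} {φ : Profile (Fin n)} {E : ℕ → ℕ → Bool}
    (hE : ∀ a b : Fin n, E a b = φ a b) (hr : ∀ a : Fin n, E n a = φ a a) {A : Finset (Fin n)}
    {j v : ℕ} {α : Multiset ℕ} (h : α ∈ labels (n + 1) E j v) (hA : ∀ a : Fin n, ↑a ∈ α → a ∈ A)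
    (hvn : v ≤ n) (hv : ∀ a : Fin n, ↑a = v → a ∈ liberal φ A) :
    ∀ a : Fin n, ↑a ∈ α → a ∈ liberal φ A := by
  induction j using Nat.strong_induction_on generalizing v α with
  | _ j ih =>
    cases j with
    | zero =>
      intro a ha
      rw [mem_labels_zero.1 h, Multiset.mem_singleton] at ha
      exact hv a ha
    | succ j =>
      obtain ⟨u, hu, hvu, i, hi, β, hβ, γ, hγ, rfl⟩ := mem_labels_succ.1 h
      have hβA := ih i (by omega) hβ (fun a ha => hA a (Multiset.mem_add.2 (.inl ha))) hvn hv
      have huγ : u ∈ γ := root_mem_labels hγ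
      have hγA := ih (j - i) (by omega) hγ (fun a ha => hA a (Multiset.mem_add.2 (.inr ha)))
        (Nat.lt_succ_iff.1 hu) fun a ha => by
          have haA : a ∈ A := hA a (Multiset.mem_add.2 (.inr (ha ▸ huγ)))
          subst ha
          rcases hvn.eq_or_lt with rfl | hvn
          · exact mem_liberal_of_self haA (by rwa [← hr])
          · exact mem_liberal_of_mem (b := ⟨v, hvn⟩) haA (hv _ rfl) (by rw [← hE]; exact hvu)
      intro a ha
      rcases Multiset.mem_add.1 ha with ha | ha
      exacts [hβA a ha, hγA a ha]

/-- The selected individuals are the labels of a branching, without repetitions. -/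
theorem exists_labels_liberal {n : ℕ} {φ : Profile (Fin n)} {E : ℕ → ℕ → Bool}
    (hE : ∀ a b : Fin n, E a b = φ a b) (hr : ∀ a : Fin n, E n a = φ a a) (A : Finset (Fin n)) :
    {n} + (liberal φ A).val.map Fin.val ∈ labels (n + 1) E (liberal φ A).card n := by
  -- Individuals are attached as leaves one by one, in an order in which selection reaches them.
  have grow : ∀ t ≤ (liberal φ A).card, ∃ D ⊆ liberal φ A, D.card = t ∧
      {n} + D.val.map Fin.val ∈ labels (n + 1) E t n := by
    intro t
    induction t with
    | zero => exact fun _ => ⟨∅, empty_subset _, rfl, mem_labels_zero.2 (by simp)⟩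
    | succ t ih =>
      intro ht
      obtain ⟨D, hDs, hDc, hD⟩ := ih (by omega)
      obtain ⟨a, ha, haD, h⟩ := exists_mem_liberal_notMem
        (hDs.ssubset_of_ne (by rintro rfl; omega))
      refine ⟨insert a D, insert_subset ha hDs, by rw [card_insert_of_notMem haD, hDc], ?_⟩
      rw [insert_val_of_notMem haD, Multiset.map_cons, ← Multiset.singleton_add,
        add_comm ({(a : ℕ)} : Multiset ℕ), ← add_assoc]
      rcases h with h | ⟨b, hb, hba⟩
      · exact add_singleton_mem_labels (x := n) hD (by simp) (by omega) (by rw [hr, h])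
      · exact add_singleton_mem_labels (x := b) hD (Multiset.mem_add.2 (.inr
          (Multiset.mem_map_of_mem _ hb))) (by omega) (by rw [hE, hba])
  obtain ⟨D, hDs, hDc, hD⟩ := grow _ le_rfl
  rwa [eq_of_subset_of_card_le hDs hDc.ge] at hD

theorem add_replicate_mem_labels {p : ℕ} {E : ℕ → ℕ → Bool} {j v : ℕ} {α : Multiset ℕ}
    (h : α ∈ labels p E j v) (hv : v < p) (he : E v v = true) (m : ℕ) :
    α + Multiset.replicate m v ∈ labels p E (j + m) v := by
  induction m with
  | zero => simpa using h
  | succ m ih =>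
    rw [Multiset.replicate_succ, ← Multiset.singleton_add,
      add_comm ({v} : Multiset ℕ) (Multiset.replicate m v), ← add_assoc α]
    exact add_singleton_mem_labels ih (Multiset.mem_add.2 (.inl (root_mem_labels h))) hv he

/-- An instance with `k ≥ 0` is a yes-instance if and only if some branching that starts at the root
and has `n + 1` nodes reaches all of `S` and has at most `k` nodes outside `T`. If `k > n + 1` the
truncated difference is `0`, and the bound is void as it should be. -/
theorem Instance.isYes_LSR_iff (I : Instance) (E : ℕ → ℕ → Bool) (q : ℕ → Bool)
    (hE : ∀ a b : Fin I.n, E a b = I.φ a b) (hr : ∀ a : Fin I.n, E I.n a = I.φ a a)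
    (hl : E I.n I.n = true) (hq : ∀ a : Fin I.n, q a = decide (a ∈ I.T)) (hqr : q I.n = true)
    (hk : 0 ≤ I.k) :
    I.IsYes LSR ↔ ∃ α ∈ labels (I.n + 1) E I.n I.n, (∀ s ∈ I.S, (s : ℕ) ∈ α) ∧
      I.n + 1 - I.k.natAbs ≤ α.countP fun a => q a = true := by
  have hcount : ∀ α ∈ labels (I.n + 1) E I.n I.n,
      (I.n + 1 - I.k.natAbs ≤ α.countP fun a => q a = true) ↔
        ((α.countP fun a => ¬ q a = true : ℕ) : ℤ) ≤ I.k := by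
    intro α hα
    have h1 := card_of_mem_labels hα
    rw [Multiset.card_eq_countP_add_countP fun a => q a = true] at h1
    omega
  constructor
  · rintro ⟨U, hU, hUk, hS⟩
    have hα := exists_labels_liberal hE hr (I.T ∪ U)
    have hc : (liberal I.φ (I.T ∪ U)).card ≤ I.n := by
      simpa using card_le_univ (liberal I.φ (I.T ∪ U))
    have hα' := add_replicate_mem_labels hα (by omega) hl
      (I.n - (liberal I.φ (I.T ∪ U)).card)
    rw [Nat.add_sub_cancel' hc] at hα'
    refine ⟨_, hα', fun s hs => ?_, (hcount _ hα').2 (le_trans ?_ hUk)⟩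
    · exact Multiset.mem_add.2 (.inl (Multiset.mem_add.2 (.inr
        (Multiset.mem_map_of_mem _ (hS hs)))))
    -- The labels outside `T` belong to `U` and occur once; the padding repeats the root only.
    · have hrest : (Multiset.replicate (I.n - (liberal I.φ (I.T ∪ U)).card) I.n).countP
          (fun a => ¬ q a = true) = 0 :=
        Multiset.countP_eq_zero.2 fun a ha => by rw [Multiset.eq_of_mem_replicate ha]; simp [hqr]
      have hroot : ({I.n} : Multiset ℕ).countP (fun a => ¬ q a = true) = 0 :=
        Multiset.countP_eq_zero.2 fun a ha => by rw [Multiset.mem_singleton.1 ha]; simp [hqr]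
      rw [Multiset.countP_add, Multiset.countP_add, hrest, hroot, Multiset.countP_map, zero_add,
        add_zero]
      norm_cast
      refine (Multiset.card_le_card ?_ : _ ≤ U.val.card)
      rw [Multiset.le_iff_subset ((liberal I.φ (I.T ∪ U)).nodup.filter _)]
      intro a ha
      obtain ⟨ha, haq⟩ := Multiset.mem_filter.1 ha
      rw [hq, decide_eq_true_iff] at haq
      exact (mem_union.1 ((mem_liberal.1 (mem_def.2 ha)).1)).resolve_left haq
  · rintro ⟨α, hα, hS, hc⟩
    have hk' := (hcount α hα).1 hc
    set U : Finset (Fin I.n) := univ.filter fun a => a ∉ I.T ∧ ↑a ∈ α with hUdef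
    refine ⟨U, fun a ha => ?_, le_trans ?_ hk', fun s hs => ?_⟩
    · exact mem_sdiff.2 ⟨mem_univ _, (mem_filter.1 ha).2.1⟩
    · norm_cast
      rw [Multiset.countP_eq_card_filter]
      have hle : U.val.map Fin.val ≤ α.filter fun a => ¬ q a = true := by
        rw [Multiset.le_iff_subset (U.nodup.map Fin.val_injective)]
        intro b hb
        obtain ⟨a, ha, rfl⟩ := Multiset.mem_map.1 hb
        obtain ⟨-, haT, haα⟩ := mem_filter.1 (mem_def.2 ha)
        exact Multiset.mem_filter.2 ⟨haα, by simp [hq, haT]⟩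
      simpa using Multiset.card_le_card hle
    · refine mem_liberal_of_mem_labels hE hr hα (fun a ha => ?_) le_rfl
        (fun a ha => absurd ha a.2.ne) s (hS s hs)
      by_cases haT : a ∈ I.T
      · exact mem_union_left _ haT
      · exact mem_union_right _ (mem_filter.2 ⟨mem_univ _, haT, ha⟩)

/-- Membership in the problem, for a word that begins with `1^n 0`. Instances with `k < 0` do not
appear on the right-hand side, because they are no-instances. -/
theorem mem_GCAI_LSR_iff {x : List Bool} {κ n : ℕ} (h1 : ∀ i < n, bit x i = true)
    (h0 : bit x n = false) : (x, κ) ∈ GCAI LSR ↔ ValidWord x κ n ∧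
      ∃ α ∈ labels (n + 1) (arc x n) n n, (∀ s ∈ wordS x n, s ∈ α) ∧
        n + 1 - wordVal (x.drop (posK n)) ≤ α.countP fun a => inside x n a = true := by
  have harc : ∀ a b : Fin n, arc x n a b = bit x (n + 1 + (a * n + b)) := fun a b => by
    rw [arc, if_neg b.2.ne, if_neg a.2.ne]
  have harcr : ∀ a : Fin n, arc x n n a = bit x (n + 1 + (a * n + a)) := fun a => by
    rw [arc, if_neg a.2.ne, if_pos rfl]
  have hins : ∀ a : Fin n, inside x n a = bit x (posT n + a) := fun a => by
    rw [inside, if_neg a.2.ne]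
  constructor
  · rintro ⟨I, hI, hyes⟩
    obtain ⟨hx, rfl⟩ := Prod.mk.inj hI
    have hlen := I.posK_le_length
    rw [← hx] at hlen
    obtain ⟨b1, b2, hφ, hS, hT, hk, hbits⟩ := (Instance.encode_eq_iff hlen).1 hx.symm
    obtain rfl : I.n = n := by
      rcases lt_trichotomy I.n n with h | h | h
      · rw [h1 _ h] at b2; cases b2
      · exact h
      · rw [b1 _ h] at h0; cases h0
    have hk0 : 0 ≤ I.k := by
      by_contra hneg
      obtain ⟨U, -, hU, -⟩ := hyes
      omega
    have hwS : wordS x I.n = I.S.map Fin.valEmbedding := by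
      ext v
      simp only [wordS, mem_filter, mem_range, mem_map, Fin.valEmbedding_apply]
      constructor
      · rintro ⟨hv, hb⟩
        exact ⟨⟨v, hv⟩, by simpa using (hS ⟨v, hv⟩).trans hb, rfl⟩
      · rintro ⟨a, ha, rfl⟩
        exact ⟨a.2, by rw [← hS a]; simpa using ha⟩
    refine ⟨⟨hlen, ?_, fun v hv hb => ?_, ?_, I.S_nonempty.card_pos, ?_⟩, ?_⟩
    · rw [← hk]; simpa using hk0
    · have hmem : (⟨v, hv⟩ : Fin I.n) ∈ I.S := by simpa using (hS ⟨v, hv⟩).trans hb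
      rw [← hT ⟨v, hv⟩]
      simpa using I.S_subset_T hmem
    · rw [hwS, card_map]
    · rw [← getLast?_drop_ne_iff, ← hbits]
      exact getLast?_bits _
    · obtain ⟨α, hα, hSα, hc⟩ := (I.isYes_LSR_iff (arc x I.n) (inside x I.n)
        (fun a b => by rw [harc, hφ]) (fun a => by rw [harcr, hφ]) (by simp [arc])
        (fun a => by rw [hins, hT]) (by simp [inside]) hk0).1 hyes
      refine ⟨α, hα, fun s hs => ?_, by rwa [← hbits, wordVal_bits]⟩
      rw [hwS] at hs
      obtain ⟨a, ha, rfl⟩ := mem_map.1 hs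
      exact hSα a ha
  · rintro ⟨hv, α, hα, hSα, hc⟩
    have hwS : ∀ a : Fin n, bit x (posS n + a) = true → ↑a ∈ wordS x n := fun a ha =>
      mem_filter.2 ⟨mem_range.2 a.2, ha⟩
    have hcard : (univ.filter fun a : Fin n => bit x (posS n + a) = true).card = κ := by
      rw [← hv.card, ← card_map Fin.valEmbedding]
      congr 1
      ext v
      simp only [wordS, mem_filter, mem_range, mem_map, mem_univ, true_and,
        Fin.valEmbedding_apply]
      constructor
      · rintro ⟨a, ha, rfl⟩
        exact ⟨a.2, ha⟩
      · rintro ⟨hv, hb⟩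
        exact ⟨⟨v, hv⟩, hb, rfl⟩
    have hsub : (univ.filter fun a : Fin n => bit x (posS n + a) = true) ⊆
        univ.filter fun a : Fin n => bit x (posT n + a) = true := fun a ha =>
      mem_filter.2 ⟨mem_univ _, hv.sub a a.2 (mem_filter.1 ha).2⟩
    have hne : (univ.filter fun a : Fin n => bit x (posS n + a) = true).Nonempty :=
      card_pos.1 (hcard ▸ hv.pos)
    have decide_filter : ∀ (a : Fin n) (f : Fin n → Bool),
        decide (a ∈ univ.filter fun a => f a = true) = f a := by simp
    set I : Instance :=
      { n := n
        φ := fun a b => bit x (n + 1 + (a * n + b))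
        S := univ.filter fun a => bit x (posS n + a) = true
        T := univ.filter fun a => bit x (posT n + a) = true
        k := wordVal (x.drop (posK n))
        S_nonempty := hne
        T_nonempty := hne.mono hsub
        S_subset_T := hsub } with hI
    refine ⟨I, Prod.ext (Eq.symm ?_) hcard.symm, ?_⟩
    · refine (Instance.encode_eq_iff (I := I) hv.length).2 ⟨h1, h0, fun _ _ => rfl,
        fun a => decide_filter a _, fun a => decide_filter a _, ?_, ?_⟩
      · simp [hI, hv.sign]
      · exact bits_wordVal ((getLast?_drop_ne_iff _ _).2 hv.last)
    · refine (I.isYes_LSR_iff (arc x n) (inside x n) harc harcr (by simp [arc, hI])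
        (fun a => (hins a).trans
          (decide_filter a fun a => bit x (posT n + a)).symm) (by simp [inside, hI])
          (by simp [hI])).2
        ⟨α, hα, fun s hs => hSα s (hwS s (mem_filter.1 hs).2), hc⟩

end GroupIdentification

/-! ### Parsing on the machine -/

namespace GroupIdentification

open Finset RAM RAM.Prog

/-- Register `3` receives the position `n` of the first `0` in the input word. -/
def findN : Prog :=
  seq (block [copy 3 0, copy 4 0]) (down 4 (block [load 5 4, branch 5 skip (copy 3 4)]))

theorem findN_runs {H : ℕ} {x : List Bool} {s : State} (hs : s.Bdd H) (hH : 1 ≤ H)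
    (h0 : s.reg 0 = x.length) (hm : ∀ a, s.mem a = (bit x a).toNat) :
    Runs H (20 * (x.length + 1)) findN s fun t => ∃ n, t.reg 3 = n ∧ n ≤ x.length ∧
      (∀ i < n, bit x i = true) ∧ bit x n = false := by
  have hend : bit x x.length = false := by simp [bit]
  refine ((Runs.straight hs (by simp [Safe, block])).seq ?_).mono (k := 6 + (x.length * 14 + 1))
    (by omega) fun _ _ h => h
  rintro t ht rfl
  set t := eval (block [copy 3 0, copy 4 0]) s with htdef
  have h3 : t.reg 3 = x.length := by simp [htdef, block, eval, h0]
  have h4 : t.reg 4 = x.length := by simp [htdef, block, eval, h0]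
  have htm : ∀ a, t.mem a = (bit x a).toNat := by simpa [htdef, block, eval] using hm
  refine (Runs.down (K := 9) (fun k t => k ≤ t.reg 3 ∧ t.reg 3 ≤ x.length ∧
      bit x (t.reg 3) = false ∧ ∀ i, k ≤ i → i < t.reg 3 → bit x i = true)
      ht hH (by decide) (by decide) h4.le (fun k t v w h => by simpa using h) ?_ ?_).mono le_rfl ?_
  · rw [h3, h4]
    exact ⟨le_rfl, le_rfl, hend, fun i h1 h2 => by omega⟩
  · rintro k u hu hk huk - - hmem ⟨i1, i2, i3, i4⟩
    have hmk : u.mem k = (bit x k).toNat := by rw [hmem rfl, htm]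
    refine (Runs.straight hu (by simp [Safe, block])).mono (by simp [block, size]) ?_
    rintro v - rfl
    by_cases hb : bit x k = true
    · simp [block, eval, huk, hmk, hb]
      refine ⟨by omega, i2, i3, fun i h1 h2 => ?_⟩
      rcases h1.eq_or_lt with rfl | h1
      exacts [hb, i4 i h1 h2]
    · simp only [Bool.not_eq_true] at hb
      simp [block, eval, huk, hmk, hb]
      exact ⟨by omega, fun i h1 h2 => by omega⟩
  · rintro u - ⟨⟨i1, i2, i3, i4⟩, -⟩
    exact ⟨_, rfl, i2, fun i hi => i4 i (Nat.zero_le i) hi, i3⟩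

/-- The positions of the parts of the encoding go to the registers `5`, …, `8`, and register `9`
receives a number that is `0` unless the length, the sign or the last digit is wrong. -/
def layout : Prog :=
  block [const 2 1, add 4 3 2, mul 5 3 3, add 5 5 4, add 6 5 3, add 7 6 3, add 8 7 2, sub 9 8 0,
    load 10 7, add 9 9 10, const 11 0, sub 12 0 8,
    branch 12 (block [sub 12 0 2, load 12 12, sub 12 2 12, add 9 9 12]) skip, copy 10 3]

theorem layout_runs {H n : ℕ} {x : List Bool} {s : State} (hs : s.Bdd H)
    (hn : n ≤ x.length) (hH : 16 * ((x.length + 1) * (x.length + 1)) ≤ H)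
    (h0 : s.reg 0 = x.length) (h3 : s.reg 3 = n) (hm : ∀ a, s.mem a = (bit x a).toNat) :
    Runs H 50 layout s fun t => t.reg 4 = n + 1 ∧ t.reg 5 = posS n ∧ t.reg 6 = posT n ∧
      t.reg 8 = posK n ∧ t.reg 10 = n ∧ t.reg 11 = 0 ∧
      t.reg 9 = posK n - x.length + (bit x (posSign n)).toNat +
        (if posK n < x.length then 1 - (bit x (x.length - 1)).toNat else 0) := by
  have hnn : n * n ≤ x.length * x.length := Nat.mul_le_mul hn hn
  have hxx : (x.length + 1) * (x.length + 1) = x.length * x.length + 2 * x.length + 1 := by ring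
  have hb := Bool.toNat_le (bit x (posSign n))
  have e5 : n * n + (n + 1) = posS n := rfl
  have e6 : posS n + n = posT n := rfl
  have e7 : posT n + n = posSign n := rfl
  have e8 : posSign n + 1 = posK n := rfl
  refine (Runs.straight hs ?_).mono (by simp [layout, block, size]) ?_
  · simp [layout, block, Safe, eval, h0, h3, hm, e5, e6, e7, e8]
    omega
  · rintro t - rfl
    simp [layout, block, eval, h0, h3, hm, e5, e6, e7, e8]
    by_cases h : x.length - posK n = 0
    · rw [if_pos h, if_neg (by omega)]
      simp [h3]
    · rw [if_neg h, if_pos (by omega)]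
      simp [h3]

/-- Register `11` receives `|S|`, and `|S \ T|` is added to register `9`. The registers `5` and `6`
hold the positions of the two characteristic words, register `10` holds `n`. -/
def scanS : Prog :=
  down 10 (block [add 12 5 10, load 12 12, add 13 6 10, load 13 13, add 11 11 12, sub 12 12 13,
    add 9 9 12])

theorem scanS_runs {H n : ℕ} {x : List Bool} {s : State} (hs : s.Bdd H)
    (hn : n ≤ x.length) (hH : s.reg 9 + posT n + n + 1 ≤ H)
    (h5 : s.reg 5 = posS n) (h6 : s.reg 6 = posT n) (h10 : s.reg 10 = n) (h11 : s.reg 11 = 0)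
    (hm : ∀ a, s.mem a = (bit x a).toNat) :
    Runs H (30 * (x.length + 1)) scanS s fun t => t.reg 11 = (wordS x n).card ∧
      t.reg 9 = s.reg 9 + ((wordS x n).filter fun v => bit x (posT n + v) = false).card := by
  have hpos : posS n ≤ posT n := Nat.le_add_right _ _
  have hstep : ∀ k < n, (((wordS x n).filter fun v => k ≤ v).card =
      ((wordS x n).filter fun v => k + 1 ≤ v).card + (bit x (posS n + k)).toNat) ∧
      (((wordS x n).filter fun v => bit x (posT n + v) = false ∧ k ≤ v).card =
      ((wordS x n).filter fun v => bit x (posT n + v) = false ∧ k + 1 ≤ v).card +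
        ((bit x (posS n + k)).toNat - (bit x (posT n + k)).toNat)) := by
    intro k hk
    have hd : ∀ q : ℕ → Prop, [DecidablePred q] → ((wordS x n).filter fun v => q v ∧ k ≤ v).card =
      ((wordS x n).filter fun v => q v ∧ k + 1 ≤ v).card +
        if bit x (posS n + k) = true ∧ q k then 1 else 0 := by
      intro q _
      have hsplit : ((wordS x n).filter fun v => q v ∧ k ≤ v) =
          ((wordS x n).filter fun v => q v ∧ k + 1 ≤ v) ∪
            if bit x (posS n + k) = true ∧ q k then {k} else ∅ := by
        ext v
        by_cases hvk : v = k
        · subst hvk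
          split_ifs with h
          · simp [wordS, h.1, h.2, hk]
          · simp only [wordS, mem_filter, mem_range, union_empty]
            constructor
            · rintro ⟨⟨-, h1⟩, h2, -⟩
              exact absurd ⟨h1, h2⟩ h
            · rintro ⟨-, -, h3⟩
              omega
        · have hkv : k ≤ v ↔ k + 1 ≤ v := by omega
          split_ifs <;> simp [hvk, hkv]
      rw [hsplit, card_union_of_disjoint]
      · split_ifs <;> simp
      · split_ifs <;> simp
    constructor
    · have := hd (fun _ => True)
      simp only [true_and, and_true] at this
      rw [this]
      cases bit x (posS n + k) <;> simp
    · rw [hd fun v => bit x (posT n + v) = false]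
      cases bit x (posS n + k) <;> cases bit x (posT n + k) <;> simp
  have hle : (wordS x n).card ≤ n := (card_filter_le _ _).trans_eq (card_range n)
  obtain ⟨f, hf⟩ : ∃ f : ℕ → ℕ, ∀ k, f k = ((wordS x n).filter fun v => k ≤ v).card :=
    ⟨_, fun _ => rfl⟩
  obtain ⟨g, hg⟩ : ∃ g : ℕ → ℕ, ∀ k, g k =
    ((wordS x n).filter fun v => bit x (posT n + v) = false ∧ k ≤ v).card := ⟨_, fun _ => rfl⟩
  have hfn : ∀ k, f k ≤ n := fun k => (hf k).trans_le ((card_filter_le _ _).trans hle)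
  have hgn : ∀ k, g k ≤ n := fun k => (hg k).trans_le ((card_filter_le _ _).trans hle)
  simp only [← hf, ← hg] at hstep
  refine (Runs.down (K := 16) (N := x.length) (fun k t => t.reg 11 = f k ∧ t.reg 9 = s.reg 9 + g k)
      hs (by omega) (by decide) (by decide) (by omega)
      (fun k t v w h => by simpa using h) ?_ ?_).mono (by omega) ?_
  · have hempty : ∀ v ∈ wordS x n, ¬ n ≤ v := fun v hv =>
      not_le.2 (mem_range.1 (mem_filter.1 hv).1)
    rw [h10, h11, hf, hg, filter_false_of_mem hempty,
      filter_false_of_mem fun v hv h => hempty v hv h.2]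
    simp
  · rintro k u hu hk huk - hr hmem ⟨i1, i2⟩
    rw [h10] at hk
    have u5 : u.reg 5 = posS n := by rw [hr 5 (by decide) (by decide) (by decide), h5]
    have u6 : u.reg 6 = posT n := by rw [hr 6 (by decide) (by decide) (by decide), h6]
    have um : ∀ a, u.mem a = (bit x a).toNat := by rwa [hmem rfl]
    obtain ⟨s1, s2⟩ := hstep k hk
    have l1 := hfn k
    have l2 := hgn k
    refine (Runs.straight hu ?_).mono (by simp [block, size]) ?_
    · simp [Safe, block, eval, huk, u5, u6, um, i1, i2]
      omega
    · rintro t - rfl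
      simp [block, eval, huk, u5, u6, um, i1, i2]
      omega
  · rintro t - ⟨⟨i1, i2⟩, -⟩
    rw [hf] at i1
    rw [hg] at i2
    simpa using And.intro i1 i2

/-- The binary digits that begin at the position in register `8` give the number in register
`14`. -/
def readK : Prog :=
  seq (block [sub 10 0 8, const 14 0])
    (down 10 (block [add 12 8 10, load 12 12, add 14 14 14, add 14 14 12]))

theorem readK_runs {H n : ℕ} {x : List Bool} {s : State} (hs : s.Bdd H)
    (hH : 2 ^ x.length ≤ H) (h0 : s.reg 0 = x.length) (h8 : s.reg 8 = posK n)
    (hm : ∀ a, s.mem a = (bit x a).toNat) :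
    Runs H (30 * (x.length + 1)) readK s fun t => t.reg 14 = wordVal (x.drop (posK n)) := by
  have hlt : x.length < 2 ^ x.length := Nat.lt_two_pow_self
  have hstep : ∀ a < x.length, wordVal (x.drop a) =
      wordVal (x.drop (a + 1)) + wordVal (x.drop (a + 1)) + (bit x a).toNat := by
    intro a ha
    rw [List.drop_eq_getElem_cons ha, wordVal_cons, Nat.bit_val]
    simp only [bit, List.getD_eq_getElem _ _ ha]
    omega
  have hle : ∀ a, wordVal (x.drop a) < 2 ^ x.length := fun a =>
    (wordVal_lt _).trans_le (Nat.pow_le_pow_right two_pos (by simp))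
  refine ((Runs.straight hs (by simp [Safe, block])).seq ?_).mono
    (k := 6 + (x.length * 15 + 1)) (by omega) fun _ _ h => h
  rintro t ht rfl
  set t := eval (block [sub 10 0 8, const 14 0]) s with htdef
  have t8 : t.reg 8 = posK n := by simp [htdef, block, eval, h8]
  have t10 : t.reg 10 = x.length - posK n := by simp [htdef, block, eval, h0, h8]
  have t14 : t.reg 14 = 0 := by simp [htdef, block, eval]
  have tm : ∀ a, t.mem a = (bit x a).toNat := by simpa [htdef, block, eval] using hm
  refine (Runs.down (K := 10) (fun k t => t.reg 14 = wordVal (x.drop (posK n + k)))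
      ht (by omega) (by decide) (by decide) (by omega) (fun k t v w h => by simpa using h) ?_
      ?_).mono le_rfl ?_
  · rw [t10, t14, List.drop_of_length_le (by omega)]
    rfl
  · rintro k u hu hk huk - hr hmem i1
    rw [t10] at hk
    have u8 : u.reg 8 = posK n := by rw [hr 8 (by decide) (by decide) (by decide), t8]
    have um : ∀ a, u.mem a = (bit x a).toNat := by rwa [hmem rfl]
    have s1 := hstep (posK n + k) (by omega)
    have l1 := hle (posK n + k)
    rw [← add_assoc] at i1
    refine (Runs.straight hu ?_).mono (by simp [block, size]) ?_
    · simp [Safe, block, eval, huk, u8, um, i1]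
      omega
    · rintro t - rfl
      simp [block, eval, huk, u8, um, i1]
      omega
  · rintro t - ⟨i1, -⟩
    exact i1

/-- Register `9` is increased unless `|S|` is positive and equal to the parameter. For numbers `a`,
`b`, the truncated differences `a - b` and `b - a` both vanish only if `a = b`. -/
def checkCard : Prog :=
  block [const 2 1, sub 12 11 1, add 9 9 12, sub 12 1 11, add 9 9 12, sub 12 2 11, add 9 9 12]

theorem checkCard_safe {H κ c b : ℕ} {v : State} (v1 : v.reg 1 = κ) (v11 : v.reg 11 = c)
    (v9 : v.reg 9 ≤ b) (hH : b + c + κ + 1 ≤ H) : checkCard.Safe H v := by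
  simp [checkCard, Safe, block, eval, v1, v11]
  omega

/-- The number that `parse` leaves in register `9` vanishes exactly on the valid words. -/
theorem validWord_iff {x : List Bool} {κ n : ℕ} : posK n - x.length + (bit x (posSign n)).toNat +
    (if posK n < x.length then 1 - (bit x (x.length - 1)).toNat else 0) +
    ((wordS x n).filter fun v => bit x (posT n + v) = false).card + ((wordS x n).card - κ) +
    (κ - (wordS x n).card) + (1 - (wordS x n).card) = 0 ↔ ValidWord x κ n := by
  have hsub : ((wordS x n).filter fun v => bit x (posT n + v) = false).card = 0 ↔
      ∀ v < n, bit x (posS n + v) = true → bit x (posT n + v) = true := by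
    simp [wordS, filter_eq_empty_iff]
  have hlast : (if posK n < x.length then 1 - (bit x (x.length - 1)).toNat else 0) = 0 ↔
      (posK n < x.length → bit x (x.length - 1) = true) := by
    split_ifs with h
    · cases bit x (x.length - 1) <;> simp [h]
    · simp [h]
  simp only [Nat.add_eq_zero_iff, hsub, hlast, Nat.sub_eq_zero_iff_le, Bool.toNat_eq_zero]
  constructor
  · rintro ⟨⟨⟨⟨⟨⟨h1, h2⟩, h3⟩, h4⟩, h5⟩, h6⟩, h7⟩
    exact ⟨h1, h2, h4, h5.antisymm h6, h7.trans h5, h3⟩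
  · rintro ⟨h1, h2, h3, h4, h5, h6⟩
    exact ⟨⟨⟨⟨⟨⟨h1, h2⟩, h6⟩, h3⟩, h4.le⟩, h4.ge⟩, h4 ▸ h5⟩

/-- Find `n` and the parts of the encoding, set register `9` to `0` if and only if the word is
valid, and compute `k`. -/
def parse : Prog :=
  seq findN (seq layout (seq scanS (seq checkCard readK)))

theorem parse_runs {H κ : ℕ} {x : List Bool} {s : State} (hs : s.Bdd H)
    (hH : 16 * ((x.length + 1) * (x.length + 1)) ≤ H) (hH' : 2 ^ x.length ≤ H)
    (h0 : s.reg 0 = x.length) (h1 : s.reg 1 = κ) (hκ : κ ≤ x.length + 1)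
    (hm : ∀ a, s.mem a = (bit x a).toNat) :
    Runs H (150 * (x.length + 1)) parse s fun t => ∃ n, n ≤ x.length ∧
      (∀ i < n, bit x i = true) ∧ bit x n = false ∧ t.reg 0 = x.length ∧ t.reg 1 = κ ∧
      t.reg 3 = n ∧ t.reg 4 = n + 1 ∧ t.reg 5 = posS n ∧ t.reg 6 = posT n ∧
      (t.reg 9 = 0 ↔ ValidWord x κ n) ∧ t.reg 14 = wordVal (x.drop (posK n)) ∧
      ∀ a, t.mem a = (bit x a).toNat := by
  have hxx : (x.length + 1) * (x.length + 1) = x.length * x.length + 2 * x.length + 1 := by ring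
  refine ((findN_runs hs (by omega) h0 hm).frame.seq (k' := 50 + (30 * (x.length + 1) + (16 +
    30 * (x.length + 1)))) ?_).mono (by omega) fun _ _ h => h
  rintro t ht ⟨⟨n, t3, hn, hn1, hn0⟩, hr, hmem⟩
  have t0 : t.reg 0 = x.length := by rw [hr 0 (by decide), h0]
  have t1 : t.reg 1 = κ := by rw [hr 1 (by decide), h1]
  have tm : ∀ a, t.mem a = (bit x a).toNat := by rwa [hmem rfl]
  clear hr hmem
  have hnn : n * n ≤ x.length * x.length := Nat.mul_le_mul hn hn
  have e5 : n * n + (n + 1) = posS n := rfl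
  have e6 : posS n + n = posT n := rfl
  have e7 : posT n + n = posSign n := rfl
  have e8 : posSign n + 1 = posK n := rfl
  have hbound : posK n + 2 + n + n + κ + 1 ≤ H := by omega
  refine (layout_runs ht hn hH t0 t3 tm).frame.seq ?_
  rintro u hu ⟨⟨u4, u5, u6, u8, u10, u11, u9⟩, hr, hmem⟩
  have u0 : u.reg 0 = x.length := by rw [hr 0 (by decide), t0]
  have u1 : u.reg 1 = κ := by rw [hr 1 (by decide), t1]
  have u3 : u.reg 3 = n := by rw [hr 3 (by decide), t3]
  have um : ∀ a, u.mem a = (bit x a).toNat := by rwa [hmem rfl]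
  clear hr hmem
  have hbad : u.reg 9 ≤ posK n + 2 := by
    have := Bool.toNat_le (bit x (posSign n))
    rw [u9]
    split_ifs <;> omega
  refine (scanS_runs hu hn (by omega) u5 u6 u10 u11 um).frame.seq ?_
  rintro v hv ⟨⟨v11, v9⟩, hr, hmem⟩
  have v0 : v.reg 0 = x.length := by rw [hr 0 (by decide), u0]
  have v1 : v.reg 1 = κ := by rw [hr 1 (by decide), u1]
  have v3 : v.reg 3 = n := by rw [hr 3 (by decide), u3]
  have v4 : v.reg 4 = n + 1 := by rw [hr 4 (by decide), u4]
  have v5 : v.reg 5 = posS n := by rw [hr 5 (by decide), u5]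
  have v6 : v.reg 6 = posT n := by rw [hr 6 (by decide), u6]
  have v8 : v.reg 8 = posK n := by rw [hr 8 (by decide), u8]
  have vm : ∀ a, v.mem a = (bit x a).toNat := by rwa [hmem rfl]
  clear hr hmem
  have hcS : (wordS x n).card ≤ n := (card_filter_le _ _).trans_eq (card_range n)
  have hcT : ((wordS x n).filter fun v => bit x (posT n + v) = false).card ≤ n :=
    (card_filter_le _ _).trans hcS
  have hsafe : checkCard.Safe H v := by
    refine checkCard_safe v1 v11 (b := posK n + 2 + n) ?_
      (le_trans (by gcongr) hbound)
    rw [v9]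
    exact Nat.add_le_add hbad hcT
  refine ((Runs.straight hv hsafe).frame.mono (k' := 16) (by decide) fun _ _ h => h).seq ?_
  rintro w hw ⟨hwe, hr, hmem⟩
  have w9 : w.reg 9 = v.reg 9 + ((wordS x n).card - κ) + (κ - (wordS x n).card) +
      (1 - (wordS x n).card) := by
    simp [hwe, checkCard, block, eval, v1, v11]
  have w0 : w.reg 0 = x.length := by rw [hr 0 (by decide), v0]
  have w1 : w.reg 1 = κ := by rw [hr 1 (by decide), v1]
  have w3 : w.reg 3 = n := by rw [hr 3 (by decide), v3]
  have w4 : w.reg 4 = n + 1 := by rw [hr 4 (by decide), v4]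
  have w5 : w.reg 5 = posS n := by rw [hr 5 (by decide), v5]
  have w6 : w.reg 6 = posT n := by rw [hr 6 (by decide), v6]
  have w8 : w.reg 8 = posK n := by rw [hr 8 (by decide), v8]
  have wm : ∀ a, w.mem a = (bit x a).toNat := by rwa [hmem rfl]
  clear hr hmem
  refine (readK_runs hw hH' w0 w8 wm).frame.mono le_rfl ?_
  rintro r - ⟨r14, hr, hmem⟩
  refine ⟨n, hn, hn1, hn0, by rw [hr 0 (by decide), w0], by rw [hr 1 (by decide), w1],
    by rw [hr 3 (by decide), w3], by rw [hr 4 (by decide), w4], by rw [hr 5 (by decide), w5],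
    by rw [hr 6 (by decide), w6], ?_, r14, by rwa [hmem rfl]⟩
  rw [hr 9 (by decide), w9, v9, u9]
  exact validWord_iff

end GroupIdentification

/-! ### The table of branching sums -/

namespace GroupIdentification

open Finset RAM RAM.Prog Branching

/-- The registers that stay fixed while branchings are counted have been set: `|x|`, `n`, `n + 1`,
the positions of the characteristic words of `S` and `T`, and the base `B`. The input word is still
in the memory. -/
structure Ready (x : List Bool) (n B : ℕ) (s : State) : Prop where
  r0 : s.reg 0 = x.length
  r3 : s.reg 3 = n
  r4 : s.reg 4 = n + 1
  r5 : s.reg 5 = posS n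
  r6 : s.reg 6 = posT n
  r9 : s.reg 9 = B
  low : ∀ a < x.length, s.mem a = (bit x a).toNat

theorem Ready.of_eq {x : List Bool} {n B : ℕ} {s t : State} (h : Ready x n B s)
    (hr : ∀ r ∈ [0, 3, 4, 5, 6, 9], t.reg r = s.reg r)
    (hm : ∀ a < x.length, t.mem a = s.mem a) : Ready x n B t := by
  simp only [List.forall_mem_cons] at hr
  obtain ⟨e0, e3, e4, e5, e6, e9, -⟩ := hr
  exact ⟨e0.trans h.r0, e3.trans h.r3, e4.trans h.r4, e5.trans h.r5, e6.trans h.r6,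
    e9.trans h.r9, fun a ha => (hm a ha).trans (h.low a ha)⟩

/-- Register `18` tells whether there is an arc from the vertex in register `11` to the vertex in
register `17`. Register `2` must hold `1`. -/
def testArc : Prog :=
  block [sub 18 3 17, sub 19 3 11,
    branch 18 (block [branch 19 (mul 18 11 3) (mul 18 17 3), add 18 18 17, add 18 18 4, load 18 18])
      (sub 18 2 19)]

theorem testArc_runs {H n B v u : ℕ} {x : List Bool} {s : State} (hs : s.Bdd H)
    (hr : Ready x n B s) (h2 : s.reg 2 = 1) (h11 : s.reg 11 = v) (h17 : s.reg 17 = u)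
    (hv : v ≤ n) (hu : u ≤ n) (hx : posK n ≤ x.length) (hH : x.length ≤ H) :
    Runs H 30 testArc s fun t => t.reg 18 = (arc x n v u).toNat := by
  have hlt : ∀ w < n, u < n → w * n + u + (n + 1) < x.length := by
    intro w hw hu
    have h1 : (w + 1) * n ≤ n * n := Nat.mul_le_mul_right n hw
    have h2 : posK n = n * n + (n + 1) + n + n + 1 := rfl
    rw [Nat.add_mul, one_mul] at h1
    omega
  have hadr : ∀ w, n + 1 + (w * n + u) = w * n + u + (n + 1) := fun w => by omega
  refine (Runs.straight hs ?_).mono (by simp [testArc, block, size]) ?_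
  · by_cases hun : n - u = 0
    · simp [testArc, block, Safe, eval, hr.r3, h17, h11, hun]
    · have a1 := hlt u (by omega) (by omega)
      by_cases hvn : n - v = 0
      · simp [testArc, block, Safe, eval, hr.r3, hr.r4, h17, h11, hun, hvn]
        omega
      · have a2 := hlt v (by omega) (by omega)
        simp [testArc, block, Safe, eval, hr.r3, hr.r4, h17, h11, hun, hvn]
        omega
  · rintro t - rfl
    by_cases hun : n - u = 0
    · obtain rfl : u = n := by omega
      by_cases hvn : v = u
      · simp [testArc, block, eval, hr.r3, h17, h11, h2, arc, hvn]
      · have : 1 - (u - v) = 0 := by omega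
        simp [testArc, block, eval, hr.r3, h17, h11, h2, arc, hvn, this]
    · have hun' : u ≠ n := by omega
      by_cases hvn : n - v = 0
      · have hvn' : v = n := by omega
        simp only [testArc, block, eval, hr.r3, h17, arc, hun', hvn', hadr]
        simp [h17, h11, hun, hvn, hr.r3, hr.r4, hr.low _ (hlt u (by omega) (by omega))]
      · have hvn' : v ≠ n := by omega
        simp [testArc, block, eval, hr.r3, hr.r4, h17, h11, hun, hvn, arc, hun', hvn', hadr,
          hr.low _ (hlt v (by omega) (by omega))]

/-- The place in the memory of the entry `(j, v)` of the table, which stands behind the input word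
and is to hold the `weightSum` for branchings with `j + 1` nodes and root `v`. -/
def cell (x : List Bool) (n j v : ℕ) : ℕ := j * (n + 1) + x.length + v

theorem cell_le {x : List Bool} {n j v : ℕ} (hn : n ≤ x.length) (hj : j ≤ n) (hv : v ≤ n) :
    cell x n j v ≤ 2 * ((x.length + 1) * (x.length + 1)) := by
  have h : j * (n + 1) ≤ x.length * (x.length + 1) := Nat.mul_le_mul (by omega) (by omega)
  unfold cell
  nlinarith

theorem cell_inj {x : List Bool} {n j v j' v' : ℕ} (hv : v ≤ n) (hv' : v' ≤ n)
    (h : cell x n j v = cell x n j' v') : j = j' ∧ v = v' := by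
  have h' : v + (n + 1) * j = v' + (n + 1) * j' := by
    unfold cell at h
    linarith
  have h1 := congrArg (· % (n + 1)) h'
  have h2 := congrArg (· / (n + 1)) h'
  simp only [Nat.add_mul_mod_self_left, Nat.add_mul_div_left _ _ (Nat.succ_pos n),
    Nat.mod_eq_of_lt (Nat.lt_succ_of_le hv), Nat.mod_eq_of_lt (Nat.lt_succ_of_le hv'),
    Nat.div_eq_of_lt (Nat.lt_succ_of_le hv), Nat.div_eq_of_lt (Nat.lt_succ_of_le hv')] at h1 h2
  omega

/-- The inner sum in `weightSum_succ`: with `v`, `u`, `j` in the registers `11`, `17`, `21`, the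
products of the entries `(i, v)` and `(j - 1 - i, u)` for `i < j` are added to register `15`.
Register `19` runs through the numbers `i`. -/
def convolve : Prog :=
  seq (copy 19 21) (down 19 (block [mul 20 19 4, add 20 20 0, add 20 20 11, load 20 20,
    sub 22 21 19, sub 22 22 2, mul 22 22 4, add 22 22 0, add 22 22 17, load 22 22,
    mul 20 20 22, add 15 15 20]))

theorem convolve_runs {H n B v u j : ℕ} {x : List Bool} {s : State} (hs : s.Bdd H)
    (hr : Ready x n B s) (h11 : s.reg 11 = v) (h17 : s.reg 17 = u) (h21 : s.reg 21 = j)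
    (hv : v ≤ n) (hu : u ≤ n) (hj : j ≤ n) (hn : n ≤ x.length)
    (hH : 16 * ((x.length + 1) * (x.length + 1)) ≤ H) {f : ℕ → ℕ → ℕ}
    (hf : ∀ i < j, ∀ w ≤ n, s.mem (cell x n i w) = f i w)
    (hfH : s.reg 15 + ∑ i ∈ range j, f i v * f (j - 1 - i) u ≤ H) :
    Runs H (50 * (x.length + 1)) convolve s fun t =>
      t.reg 15 = s.reg 15 + ∑ i ∈ range j, f i v * f (j - 1 - i) u := by
  refine ((Runs.straight hs (by simp [Safe])).seq ?_).mono
    (k := 2 + (x.length * 31 + 1)) (by omega) fun _ _ h => h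
  rintro t ht rfl
  refine (Runs.down (K := 26) (N := x.length) (fun k t => t.reg 15 = s.reg 15 +
      ∑ i ∈ Ico k j, f i v * f (j - 1 - i) u)
      ht (le_trans (by nlinarith) hH) (by decide) (by decide) (by simp [eval, h21]; omega)
      (fun k t v w h => by simpa using h) ?_ ?_).mono le_rfl ?_
  · simp [eval, h21]
  · rintro k w hw hk hwk hw2 hframe hmem i1
    have hkj : k < j := by simpa [eval, h21] using hk
    have w0 : w.reg 0 = x.length := by
      rw [hframe 0 (by decide) (by decide) (by decide)]; simp [eval, hr.r0]
    have w4 : w.reg 4 = n + 1 := by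
      rw [hframe 4 (by decide) (by decide) (by decide)]; simp [eval, hr.r4]
    have w11 : w.reg 11 = v := by
      rw [hframe 11 (by decide) (by decide) (by decide)]; simp [eval, h11]
    have w17 : w.reg 17 = u := by
      rw [hframe 17 (by decide) (by decide) (by decide)]; simp [eval, h17]
    have w21 : w.reg 21 = j := by
      rw [hframe 21 (by decide) (by decide) (by decide)]; simp [eval, h21]
    have wm : ∀ i < j, ∀ a ≤ n, w.mem (i * (n + 1) + x.length + a) = f i a := by
      rw [hmem rfl]
      exact hf
    have m1 := wm k hkj v hv
    have m2 := wm (j - k - 1) (by omega) u hu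
    have hsum : ∑ i ∈ Ico k j, f i v * f (j - 1 - i) u =
        f k v * f (j - k - 1) u + ∑ i ∈ Ico (k + 1) j, f i v * f (j - 1 - i) u := by
      rw [sum_eq_sum_Ico_succ_bot hkj, show j - 1 - k = j - k - 1 by omega]
    have hle : ∑ i ∈ Ico k j, f i v * f (j - 1 - i) u ≤
        ∑ i ∈ range j, f i v * f (j - 1 - i) u :=
      sum_le_sum_of_subset fun i hi => mem_range.2 (mem_Ico.1 hi).2
    have c1 : k * (n + 1) + x.length + v ≤ _ := cell_le hn (by omega) hv
    have c2 : (j - k - 1) * (n + 1) + x.length + u ≤ _ :=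
      cell_le (j := j - k - 1) hn (by omega) hu
    rw [hsum] at hle
    rw [hsum]
    generalize ∑ i ∈ Ico (k + 1) j, f i v * f (j - 1 - i) u = σ at *
    refine (Runs.straight hw ?_).mono (by simp [block, size]) ?_
    · simp [Safe, block, eval, hwk, hw2, w0, w4, w11, w17, w21, m1, m2, i1]
      generalize (x.length + 1) * (x.length + 1) = q at *
      generalize f k v * f (j - k - 1) u = π at *
      generalize k * (n + 1) = a at *
      generalize (j - k - 1) * (n + 1) = b at *
      omega
    · rintro t - rfl
      simp [block, eval, hwk, hw2, w0, w4, w11, w17, w21, m1, m2, i1]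
      omega
  · rintro w - ⟨i1, -⟩
    rw [i1, range_eq_Ico]

/-- The entry `(j, v)` is computed in register `15`, with `v` and `j` in the registers `11` and
`21`. -/
def entry : Prog :=
  seq (block [const 15 0, copy 17 4]) (down 17 (seq testArc (branch 18 convolve skip)))

theorem entry_runs {H n B v j : ℕ} {x : List Bool} {s : State} (hs : s.Bdd H)
    (hr : Ready x n B s) (h11 : s.reg 11 = v) (h21 : s.reg 21 = j + 1)
    (hv : v ≤ n) (hj : j + 1 ≤ n) (hn : n ≤ x.length) (hx : posK n ≤ x.length)
    (hH : 16 * ((x.length + 1) * (x.length + 1)) ≤ H) {w : ℕ → ℕ}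
    (hf : ∀ i < j + 1, ∀ a ≤ n, s.mem (cell x n i a) = weightSum (n + 1) (arc x n) w i a)
    (hfH : weightSum (n + 1) (arc x n) w (j + 1) v ≤ H) :
    Runs H (100 * (x.length + 1) ^ 2) entry s fun t =>
      t.reg 15 = weightSum (n + 1) (arc x n) w (j + 1) v := by
  have hHx : x.length + 1 ≤ H := le_trans (by nlinarith) hH
  rw [weightSum_succ] at hfH ⊢
  set g : ℕ → ℕ := fun u => if arc x n v u = true then ∑ i ∈ range (j + 1),
    weightSum (n + 1) (arc x n) w i v * weightSum (n + 1) (arc x n) w (j - i) u else 0 with hg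
  refine ((Runs.straight hs (by simp [Safe, block])).seq ?_).mono
    (k := 6 + ((x.length + 1) * ((30 + (50 * (x.length + 1) + 1)) + 5) + 1))
    (by nlinarith) fun _ _ h => h
  rintro t ht rfl
  set t := eval (block [const 15 0, copy 17 4]) s with htdef
  have tr : Ready x n B t := hr.of_eq (by simp [htdef, block, eval]) (by simp [htdef, block, eval])
  have t11 : t.reg 11 = v := by simp [htdef, block, eval, h11]
  have t15 : t.reg 15 = 0 := by simp [htdef, block, eval]
  have t17 : t.reg 17 = n + 1 := by simp [htdef, block, eval, hr.r4]
  have t21 : t.reg 21 = j + 1 := by simp [htdef, block, eval, h21]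
  have tm : t.mem = s.mem := by simp [htdef, block, eval]
  clear_value t
  refine (Runs.down (fun k t => t.reg 15 = ∑ u ∈ Ico k (n + 1), g u)
      ht (by omega) (by decide) (by decide) (by omega)
      (fun k t v w h => by simpa using h) ?_ ?_).mono le_rfl ?_
  · simp [t15, t17]
  · rintro u y hy hu hyu hy2 hframe hmem i1
    rw [t17] at hu
    have yr : Ready x n B y := tr.of_eq
      (fun r h => by
        obtain ⟨a1, a2, a3⟩ := (by decide : ∀ r ∈ [0, 3, 4, 5, 6, 9], r ≠ 17 ∧ r ≠ 2 ∧
          r ∉ (seq testArc (branch 18 convolve skip)).writes) r h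
        exact hframe r a1 a2 a3)
      (fun a _ => by rw [hmem rfl])
    have y11 : y.reg 11 = v := by rw [hframe 11 (by decide) (by decide) (by decide), t11]
    have y21 : y.reg 21 = j + 1 := by rw [hframe 21 (by decide) (by decide) (by decide), t21]
    have ym : y.mem = s.mem := by rw [hmem rfl, tm]
    clear hframe hmem
    have hsum : ∑ u ∈ Ico u (n + 1), g u = ∑ u ∈ Ico (u + 1) (n + 1), g u + g u := by
      rw [sum_eq_sum_Ico_succ_bot hu, add_comm]
    have hle : ∑ u ∈ Ico u (n + 1), g u ≤ ∑ u ∈ range (n + 1), g u :=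
      sum_le_sum_of_subset fun i hi => mem_range.2 (mem_Ico.1 hi).2
    rw [hsum, ← i1] at hle
    rw [hsum, ← i1]
    refine (testArc_runs hy yr hy2 y11 hyu hv (by omega) hx (by omega)).frame.seq ?_
    rintro z hz ⟨z18, hframe, hmem⟩
    have zr : Ready x n B z := yr.of_eq
      (fun r h => hframe r ((by decide : ∀ r ∈ [0, 3, 4, 5, 6, 9], r ∉ testArc.writes) r h))
      (fun a _ => by rw [hmem rfl])
    have z11 : z.reg 11 = v := by rw [hframe 11 (by decide), y11]
    have z15 : z.reg 15 = y.reg 15 := hframe 15 (by decide)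
    have z17 : z.reg 17 = u := by rw [hframe 17 (by decide), hyu]
    have z21 : z.reg 21 = j + 1 := by rw [hframe 21 (by decide), y21]
    have zm : z.mem = s.mem := by rw [hmem rfl, ym]
    clear hframe hmem
    refine Runs.branch hz (fun h => ?_) (fun h => ?_)
    · have harc : arc x n v u = true := by
        rw [z18] at h
        simpa using h
      have hgu : g u = ∑ i ∈ range (j + 1), weightSum (n + 1) (arc x n) w i v *
          weightSum (n + 1) (arc x n) w (j + 1 - 1 - i) u := by
        rw [hg]
        simp only [harc, if_true, Nat.add_sub_cancel]
      rw [← z15, hgu]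
      exact convolve_runs hz zr z11 z17 z21 hv (by omega) hj hn hH
        (f := weightSum (n + 1) (arc x n) w) (by rwa [zm]) (by rw [z15, ← hgu]; exact hle.trans hfH)
    · have harc : arc x n v u = false := by
        rw [z18] at h
        simpa using h
      exact Runs.skip hz (by rw [z15, hg]; simp [harc]) (by omega)
  · rintro y - ⟨i1, -⟩
    rw [i1, range_eq_Ico]

/-- The table is filled row by row. Row `0`, for the branchings with one node, must be there. -/
def fillTable : Prog :=
  seq (copy 10 3) (down 10 (seq (block [sub 21 3 10, copy 11 4]) (down 11
    (seq entry (block [mul 20 21 4, add 20 20 0, add 20 20 11, store 20 15])))))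

/-- The inner loop of `fillTable` computes row `j + 1`. -/
theorem fillRow_runs {H n B j : ℕ} {x : List Bool} {s : State} (hs : s.Bdd H)
    (hr : Ready x n B s) (h11 : s.reg 11 = n + 1) (h21 : s.reg 21 = j + 1) (hj : j + 1 ≤ n)
    (hn : n ≤ x.length) (hx : posK n ≤ x.length)
    (hH : 16 * ((x.length + 1) * (x.length + 1)) ≤ H) {w : ℕ → ℕ}
    (hf : ∀ i < j + 1, ∀ a ≤ n, s.mem (cell x n i a) = weightSum (n + 1) (arc x n) w i a)
    (hfH : ∀ v, weightSum (n + 1) (arc x n) w (j + 1) v ≤ H) :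
    Runs H (120 * (x.length + 1) ^ 3) (down 11
      (seq entry (block [mul 20 21 4, add 20 20 0, add 20 20 11, store 20 15]))) s fun t =>
      (∀ i < j + 2, ∀ a ≤ n, t.mem (cell x n i a) = weightSum (n + 1) (arc x n) w i a) ∧
        ∀ a < x.length, t.mem a = s.mem a := by
  have hHx : x.length + 1 ≤ H := le_trans (by nlinarith) hH
  refine (Runs.down (K := 100 * (x.length + 1) ^ 2 + 10) (N := x.length + 1) (fun k t =>
      (∀ i < j + 1, ∀ a ≤ n, t.mem (cell x n i a) = weightSum (n + 1) (arc x n) w i a) ∧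
      (∀ a ≤ n, k ≤ a → t.mem (cell x n (j + 1) a) = weightSum (n + 1) (arc x n) w (j + 1) a) ∧
      ∀ a < x.length, t.mem a = s.mem a)
      hs (by omega) (by decide) (by decide) (by omega)
      (fun k t v w h => by simpa using h) ?_ ?_).mono ?_ ?_
  · exact ⟨hf, fun a h1 h2 => by omega, fun _ _ => rfl⟩
  · rintro v y hy hv hyv - hframe - ⟨i1, i2, i3⟩
    rw [h11] at hv
    have yr : Ready x n B y := hr.of_eq
      (fun r h => by
        obtain ⟨a1, a2, a3⟩ := (by decide : ∀ r ∈ [0, 3, 4, 5, 6, 9], r ≠ 11 ∧ r ≠ 2 ∧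
          r ∉ (seq entry (block [mul 20 21 4, add 20 20 0, add 20 20 11, store 20 15])).writes) r h
        exact hframe r a1 a2 a3) i3
    have y21 : y.reg 21 = j + 1 := by rw [hframe 21 (by decide) (by decide) (by decide), h21]
    clear hframe
    refine (entry_runs hy yr hyv y21 (by omega) hj hn hx hH i1 (hfH v)).frame.seq ?_
    rintro z hz ⟨z15, hframe, hmem⟩
    have z0 : z.reg 0 = x.length := by rw [hframe 0 (by decide), yr.r0]
    have z4 : z.reg 4 = n + 1 := by rw [hframe 4 (by decide), yr.r4]
    have z11 : z.reg 11 = v := by rw [hframe 11 (by decide), hyv]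
    have z21 : z.reg 21 = j + 1 := by rw [hframe 21 (by decide), y21]
    have zm : z.mem = y.mem := hmem rfl
    clear hframe hmem
    have c1 : (j + 1) * (n + 1) + x.length + v ≤ _ := cell_le (j := j + 1) hn (by omega)
      (Nat.lt_succ_iff.1 hv)
    refine (Runs.straight hz ?_).mono (by simp [block, size]) ?_
    · simp [Safe, block, eval, z0, z4, z11, z21]
      generalize (x.length + 1) * (x.length + 1) = q at *
      generalize (j + 1) * (n + 1) = a at *
      omega
    · rintro t - rfl
      have tm : (eval (block [mul 20 21 4, add 20 20 0, add 20 20 11, store 20 15]) z).mem =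
          Function.update y.mem (cell x n (j + 1) v)
            (weightSum (n + 1) (arc x n) w (j + 1) v) := by
        simp [block, eval, z0, z4, z11, z21, z15, zm, cell]
      rw [tm]
      refine ⟨fun i hi a ha => ?_, fun a ha hva => ?_, fun a ha => ?_⟩
      · rw [Function.update_of_ne, i1 i hi a ha]
        intro h
        have := (cell_inj ha (by omega) h).1
        omega
      · rcases hva.eq_or_lt with rfl | hva
        · rw [Function.update_self]
        · rw [Function.update_of_ne, i2 a ha hva]
          intro h
          have := (cell_inj ha (by omega) h).2
          omega
      · rw [Function.update_of_ne, i3 a ha]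
        unfold cell
        omega
  · nlinarith [sq_nonneg x.length]
  · rintro t - ⟨⟨i1, i2, i3⟩, -⟩
    refine ⟨fun i hi a ha => ?_, i3⟩
    rcases Nat.lt_succ_iff_lt_or_eq.1 hi with hi | rfl
    exacts [i1 i hi a ha, i2 a ha (Nat.zero_le a)]

theorem fillTable_runs {H n B : ℕ} {x : List Bool} {s : State} (hs : s.Bdd H)
    (hr : Ready x n B s) (hn : n ≤ x.length) (hx : posK n ≤ x.length)
    (hH : 16 * ((x.length + 1) * (x.length + 1)) ≤ H) {w : ℕ → ℕ}
    (hf : ∀ a ≤ n, s.mem (cell x n 0 a) = w a)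
    (hfH : ∀ j ≤ n, ∀ v, weightSum (n + 1) (arc x n) w j v ≤ H) :
    Runs H (150 * (x.length + 1) ^ 4) fillTable s fun t =>
      t.mem (cell x n n n) = weightSum (n + 1) (arc x n) w n n ∧
        ∀ a < x.length, t.mem a = s.mem a := by
  have hHx : x.length + 1 ≤ H := le_trans (by nlinarith) hH
  have hN3 : (x.length + 1) ^ 3 ≤ (x.length + 1) ^ 4 := Nat.pow_le_pow_right (by omega) (by omega)
  have hN1 : x.length + 1 ≤ (x.length + 1) ^ 4 := Nat.le_self_pow (by omega) _
  refine ((Runs.straight hs (by simp [Safe])).seq ?_).mono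
    (k := 2 + ((x.length + 1) * ((6 + 120 * (x.length + 1) ^ 3) + 5) + 1)) ?_ fun _ _ h => h
  · rintro t ht rfl
    set t := eval (copy 10 3) s with htdef
    have tr : Ready x n B t := hr.of_eq (by simp [htdef, eval]) (by simp [htdef, eval])
    have t10 : t.reg 10 = n := by simp [htdef, eval, hr.r3]
    have tm : t.mem = s.mem := by simp [htdef, eval]
    clear_value t
    refine (Runs.down (fun k t => (∀ i < n - k + 1, ∀ a ≤ n,
        t.mem (cell x n i a) = weightSum (n + 1) (arc x n) w i a) ∧
        ∀ a < x.length, t.mem a = s.mem a)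
        ht (by omega) (by decide) (by decide) (by omega)
        (fun k t v w h => by simpa using h) ?_ ?_).mono le_rfl ?_
    · rw [t10, tm]
      refine ⟨fun i hi a ha => ?_, fun _ _ => rfl⟩
      obtain rfl : i = 0 := by omega
      rw [hf a ha, weightSum_zero]
    · rintro k y hy hk hyk - hframe - ⟨i1, i2⟩
      rw [t10] at hk
      -- The loop counts down, so the pass with counter `k` treats row `n - k`.
      obtain ⟨j, hj⟩ : ∃ j, n - k = j + 1 := ⟨n - k - 1, by omega⟩
      have hj' : n - (k + 1) + 1 = j + 1 := by omega
      rw [hj'] at i1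
      rw [hj]
      have yr : Ready x n B y := tr.of_eq
        (fun r h => by
          obtain ⟨a1, a2, a3⟩ := (by decide : ∀ r ∈ [0, 3, 4, 5, 6, 9], r ≠ 10 ∧ r ≠ 2 ∧
            r ∉ (seq (block [sub 21 3 10, copy 11 4]) (down 11 (seq entry
              (block [mul 20 21 4, add 20 20 0, add 20 20 11, store 20 15])))).writes) r h
          exact hframe r a1 a2 a3) (fun a ha => by rw [i2 a ha, tm])
      clear hframe
      refine (Runs.straight hy (by simp [Safe, block])).seq ?_
      rintro z hz rfl
      set z := eval (block [sub 21 3 10, copy 11 4]) y with hzdef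
      have zr : Ready x n B z := yr.of_eq (by simp [hzdef, block, eval])
        (by simp [hzdef, block, eval])
      have z11 : z.reg 11 = n + 1 := by simp [hzdef, block, eval, yr.r4]
      have z21 : z.reg 21 = j + 1 := by simp [hzdef, block, eval, yr.r3, hyk, hj]
      have zm : z.mem = y.mem := by simp [hzdef, block, eval]
      clear_value z
      refine (fillRow_runs hz zr z11 z21 (by omega) hn hx hH (by rwa [zm])
        (hfH (j + 1) (by omega))).mono le_rfl ?_
      rintro t - ⟨a1, a2⟩
      exact ⟨a1, fun a ha => by rw [a2 a ha, zm, i2 a ha]⟩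
    · rintro y - ⟨⟨i1, i2⟩, -⟩
      exact ⟨i1 n (by omega) n le_rfl, i2⟩
  · have : (x.length + 1) * (120 * (x.length + 1) ^ 3) = 120 * (x.length + 1) ^ 4 := by ring
    nlinarith

end GroupIdentification

/-! ### One round of inclusion and exclusion -/

namespace GroupIdentification

open Finset RAM RAM.Prog Branching

/-- The weight of the individual in register `10` is stored, and if this individual is distinguished
then the next digit of the code in register `15` is consumed; register `16` is the parity of the
number of excluded individuals. -/
def weightStep : Prog :=
  block [add 17 6 10, load 17 17, branch 17 (copy 18 9) (const 18 1), add 17 5 10, load 17 17,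
    branch 17 (block [const 19 2, div 20 15 19, mul 19 20 19, sub 19 15 19, copy 15 20,
      branch 19 (block [const 18 0, sub 16 2 16]) skip]) skip,
    add 17 0 10, store 17 18]

theorem weightStep_runs {H n B k : ℕ} {x : List Bool} {s : State} (hs : s.Bdd H)
    (hr : Ready x n B s) (h2 : s.reg 2 = 1) (h10 : s.reg 10 = k) (hk : k < n)
    (hx : posK n ≤ x.length)
    (hH : 16 * ((x.length + 1) * (x.length + 1)) ≤ H) :
    Runs H 60 weightStep s fun t =>
      (t.reg 15 = if bit x (posS n + k) = true then s.reg 15 / 2 else s.reg 15) ∧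
      (t.reg 16 = if bit x (posS n + k) = true ∧ s.reg 15 % 2 = 1 then 1 - s.reg 16
        else s.reg 16) ∧
      t.mem = Function.update s.mem (cell x n 0 k)
        (if bit x (posS n + k) = true ∧ s.reg 15 % 2 = 1 then 0
          else if bit x (posT n + k) = true then B else 1) := by
  have e6 : posS n + n = posT n := rfl
  have e7 : posT n + n + 1 = posK n := rfl
  have hS := hr.low (posS n + k) (by omega)
  have hT := hr.low (posT n + k) (by omega)
  have h15 := hs.1 15
  have hdiv : s.reg 15 / 2 * 2 ≤ s.reg 15 := Nat.div_mul_le_self _ _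
  have hmod : s.reg 15 - s.reg 15 / 2 * 2 = s.reg 15 % 2 := by omega
  have hHx : posK n + x.length + 2 ≤ H := by nlinarith
  have a1 : posT n + k ≤ H := by omega
  have a2 : posS n + k ≤ H := by omega
  have a3 : x.length + k ≤ H := by omega
  have a4 : s.reg 15 / 2 * 2 ≤ H := hdiv.trans h15
  have a5 : 1 ≤ H := by omega
  have a6 : 2 ≤ H := by omega
  have hcell : cell x n 0 k = x.length + k := by simp [cell]
  rw [hcell]
  rcases Nat.mod_two_eq_zero_or_one (s.reg 15) with hc | hc <;>
    cases hbS : bit x (posS n + k) <;> cases hbT : bit x (posT n + k) <;>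
    rw [hbS] at hS <;> rw [hbT] at hT <;> rw [hc] at hmod <;>
    refine (Runs.straight hs ?_).mono (by decide) ?_ <;>
    first
    | rintro t - rfl
      simp [weightStep, block, eval, hr.r0, hr.r5, hr.r6, hr.r9, h2, h10, hS, hT, hmod, hc]
    | simp [weightStep, Safe, block, eval, hr.r0, hr.r5, hr.r6, hr.r9, h2, h10, hS, hT, hmod, a1,
        a2, a3, a4, a5, a6]

/-- The first row of the table: the weights for the set of excluded individuals whose code is in
register `12`. -/
def weights : Prog :=
  seq (block [copy 15 12, const 16 0, copy 10 3]) (seq (down 10 weightStep)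
    (block [add 17 0 3, store 17 9]))

theorem weights_runs {H n B : ℕ} {x : List Bool} {s : State} (hs : s.Bdd H)
    (hr : Ready x n B s) (hn : n ≤ x.length) (hx : posK n ≤ x.length)
    (hH : 16 * ((x.length + 1) * (x.length + 1)) ≤ H) :
    Runs H (80 * (x.length + 1)) weights s fun t =>
      (∀ v ≤ n, t.mem (cell x n 0 v) = avoidWeight (inside x n) B
        (decode (fun v => bit x (posS n + v)) n (s.reg 12)) v) ∧
      (∀ a < x.length, t.mem a = s.mem a) ∧ t.reg 16 ≤ 1 ∧
      (t.reg 16 ≠ 0 ↔ Odd (decode (fun v => bit x (posS n + v)) n (s.reg 12)).card) := by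
  have hHx : 2 * x.length + 1 ≤ H := le_trans (by nlinarith) hH
  set S : ℕ → Bool := fun v => bit x (posS n + v) with hS
  set D := decode S n (s.reg 12) with hD
  refine ((Runs.straight hs (by simp [Safe, block])).seq (k' := (x.length * 65 + 1) + 6)
    ?_).mono (k := 8 + ((x.length * 65 + 1) + 6)) (by omega) fun _ _ h => h
  rintro t ht rfl
  set t := eval (block [copy 15 12, const 16 0, copy 10 3]) s with htdef
  have tr : Ready x n B t := hr.of_eq (by simp [htdef, block, eval]) (by simp [htdef, block, eval])
  have t10 : t.reg 10 = n := by simp [htdef, block, eval, hr.r3]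
  have t15 : t.reg 15 = s.reg 12 := by simp [htdef, block, eval]
  have t16 : t.reg 16 = 0 := by simp [htdef, block, eval]
  have tm : t.mem = s.mem := by simp [htdef, block, eval]
  clear_value t
  refine (Runs.down (K := 60) (N := x.length) (fun k t =>
      (∀ v < n, k ≤ v → t.mem (cell x n 0 v) = avoidWeight (inside x n) B D v) ∧
      (∀ a < x.length, t.mem a = s.mem a) ∧ t.reg 16 ≤ 1 ∧
      (∀ v < k, v ∈ D ↔ v ∈ decode S k (t.reg 15)) ∧
      (t.reg 16 + (decode S k (t.reg 15)).card) % 2 = D.card % 2)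
      ht (by omega) (by decide) (by decide) (by omega)
      (fun k t v w h => by simpa using h) ?_ ?_).seq ?_
  · rw [t10, t15, t16, tm]
    exact ⟨fun v h1 h2 => by omega, fun _ _ => rfl, Nat.zero_le _, fun v _ => Iff.rfl,
      by rw [zero_add]⟩
  · rintro k y hy hk hyk hy2 hframe - ⟨i1, i2, i3, i4, i5⟩
    rw [t10] at hk
    have yr : Ready x n B y := tr.of_eq
      (fun r h => by
        obtain ⟨a1, a2, a3⟩ := (by decide : ∀ r ∈ [0, 3, 4, 5, 6, 9], r ≠ 10 ∧ r ≠ 2 ∧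
          r ∉ weightStep.writes) r h
        exact hframe r a1 a2 a3) (fun a ha => by rw [i2 a ha, tm])
    clear hframe
    have hkd : ∀ c, k ∉ decode S k c := fun c h => (lt_of_mem_decode h).false
    have hins : inside x n k = bit x (posT n + k) := by rw [inside, if_neg hk.ne]
    have hSk : S k = bit x (posS n + k) := rfl
    refine (weightStep_runs hy yr hy2 hyk hk hx hH).mono le_rfl ?_
    rintro z - ⟨z15, z16, zm⟩
    rw [← hSk] at z15 z16 zm
    rw [decode] at i4 i5
    have hmemk : k ∈ D ↔ S k = true ∧ y.reg 15 % 2 = 1 := by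
      rw [i4 k (Nat.lt_succ_self k)]
      clear_value S
      split_ifs with h1 h2
      · simp [h1, h2]
      · simp [h2, hkd]
      · simp [h1, hkd]
    refine ⟨fun v hv hkv => ?_, fun a ha => ?_, ?_, fun v hv => ?_, ?_⟩
    · rw [zm]
      rcases hkv.eq_or_lt with rfl | hkv
      · rw [Function.update_self]
        simp only [avoidWeight, hmemk, hins]
      · rw [Function.update_of_ne, i1 v hv hkv]
        intro h
        have := (cell_inj hv.le hk.le h).2
        omega
    · rw [zm, Function.update_of_ne, i2 a ha]
      unfold cell
      omega
    · rw [z16]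
      split_ifs <;> omega
    · rw [i4 v (hv.trans (Nat.lt_succ_self k)), z15]
      split_ifs with h1 h2
      · simp [hv.ne]
      · rfl
      · rfl
    · rw [← i5, z15, z16]
      by_cases h1 : S k = true
      · by_cases h2 : y.reg 15 % 2 = 1
        · simp only [h1, h2, if_true, and_self, card_insert_of_notMem (hkd _)]
          omega
        · simp only [h1, h2, if_true, if_false, and_false]
      · simp [h1]
  · rintro y hy ⟨⟨i1, i2, i3, i4, i5⟩, -, hframe, -⟩
    have y0 : y.reg 0 = x.length := by rw [hframe 0 (by decide) (by decide) (by decide), tr.r0]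
    have y3 : y.reg 3 = n := by rw [hframe 3 (by decide) (by decide) (by decide), tr.r3]
    have y9 : y.reg 9 = B := by rw [hframe 9 (by decide) (by decide) (by decide), tr.r9]
    clear hframe
    refine (Runs.straight hy ?_).mono (by simp [block, size]) ?_
    · simp [Safe, block, y0, y3]
      omega
    · rintro z - rfl
      have zm : (eval (block [add 17 0 3, store 17 9]) y).mem =
          Function.update y.mem (cell x n 0 n) B := by
        simp [block, eval, y0, y3, y9, cell]
      have z16 : (eval (block [add 17 0 3, store 17 9]) y).reg 16 = y.reg 16 := by
        simp [block, eval]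
      rw [zm, z16]
      refine ⟨fun v hv => ?_, fun a ha => ?_, i3, ?_⟩
      · rcases hv.eq_or_lt with rfl | hv
        · have : v ∉ D := fun h => (lt_of_mem_decode h).false
          rw [Function.update_self]
          simp [avoidWeight, this, inside]
        · rw [Function.update_of_ne, i1 v hv (Nat.zero_le v)]
          intro h
          have := (cell_inj hv.le le_rfl h).2
          omega
      · rw [Function.update_of_ne, i2 a ha]
        unfold cell
        omega
      · rw [Nat.odd_iff, ← i5, decode, card_empty]
        omega

/-- One round: the weights of the branchings that avoid the set with the code in register `12` are
summed, and the result is added to register `13` or `14`, according to the parity of the set. -/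
def exclusionRound : Prog :=
  seq weights (seq fillTable (block [mul 20 3 4, add 20 20 0, add 20 20 3, load 20 20,
    branch 16 (add 13 13 20) (add 14 14 20)]))

/-- The sum of the weights of the branchings that start at the root, have `n + 1` nodes and avoid the
set with code `c`. -/
def codeTerm (x : List Bool) (n B c : ℕ) : ℕ :=
  weightSum (n + 1) (arc x n) (avoidWeight (inside x n) B
    (decode (fun v => bit x (posS n + v)) n c)) n n

theorem exclusionRound_runs {H n B G : ℕ} {x : List Bool} {s : State} (hs : s.Bdd H)
    (hr : Ready x n B s) (hn : n ≤ x.length) (hx : posK n ≤ x.length)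
    (hH : 16 * ((x.length + 1) * (x.length + 1)) ≤ H)
    (hG : ∀ j ≤ n, ∀ X v,
      weightSum (n + 1) (arc x n) (avoidWeight (inside x n) B X) j v ≤ G)
    (h13 : s.reg 13 + G ≤ H) (h14 : s.reg 14 + G ≤ H) :
    Runs H (300 * (x.length + 1) ^ 4) exclusionRound s fun t =>
      (∀ a < x.length, t.mem a = s.mem a) ∧
      (t.reg 13 = s.reg 13 + if Odd (decode (fun v => bit x (posS n + v)) n (s.reg 12)).card
        then codeTerm x n B (s.reg 12) else 0) ∧
      t.reg 14 = s.reg 14 + if ¬ Odd (decode (fun v => bit x (posS n + v)) n (s.reg 12)).card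
        then codeTerm x n B (s.reg 12) else 0 := by
  have hN1 : x.length + 1 ≤ (x.length + 1) ^ 4 := Nat.le_self_pow (by omega) _
  refine ((weights_runs hs hr hn hx hH).frame.seq
    (k' := 150 * (x.length + 1) ^ 4 + 20) ?_).mono (by omega) fun _ _ h => h
  rintro t ht ⟨⟨tw, tm, t16, todd⟩, hframe, -⟩
  have tr : Ready x n B t := hr.of_eq
    (fun r h => hframe r ((by decide : ∀ r ∈ [0, 3, 4, 5, 6, 9], r ∉ weights.writes) r h)) tm
  have t13 : t.reg 13 = s.reg 13 := hframe 13 (by decide)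
  have t14 : t.reg 14 = s.reg 14 := hframe 14 (by decide)
  clear hframe
  have hterm : codeTerm x n B (s.reg 12) ≤ G := hG n le_rfl _ _
  simp only [← todd]
  refine (fillTable_runs ht tr hn hx hH tw fun j hj v => (hG j hj _ v).trans
    (by omega)).frame.seq ?_
  rintro u hu ⟨⟨uw, um⟩, hframe, -⟩
  have u0 : u.reg 0 = x.length := by rw [hframe 0 (by decide), tr.r0]
  have u3 : u.reg 3 = n := by rw [hframe 3 (by decide), tr.r3]
  have u4 : u.reg 4 = n + 1 := by rw [hframe 4 (by decide), tr.r4]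
  have u13 : u.reg 13 = s.reg 13 := by rw [hframe 13 (by decide), t13]
  have u14 : u.reg 14 = s.reg 14 := by rw [hframe 14 (by decide), t14]
  have u16 : u.reg 16 = t.reg 16 := hframe 16 (by decide)
  clear hframe
  have hmem : ∀ a < x.length, u.mem a = s.mem a := fun a ha => by rw [um a ha, tm a ha]
  have uw' : u.mem (n * (n + 1) + x.length + n) = codeTerm x n B (s.reg 12) := uw
  have c1 : n * (n + 1) + x.length + n ≤ _ := cell_le hn le_rfl le_rfl
  generalize codeTerm x n B (s.reg 12) = π at *
  have a1 : n * (n + 1) + x.length + n ≤ H := by omega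
  have a2 : n * (n + 1) + x.length ≤ H := by omega
  have a3 : n * (n + 1) ≤ H := by omega
  have a4 : s.reg 13 + π ≤ H := by omega
  have a5 : s.reg 14 + π ≤ H := by omega
  refine (Runs.straight hu ?_).mono (by decide) ?_
  · by_cases h : t.reg 16 = 0 <;>
      simp [Safe, block, eval, u0, u3, u4, u13, u14, u16, uw', h, a1, a2, a3, a4, a5]
  · rintro v - rfl
    by_cases h : t.reg 16 = 0
    · simp [block, eval, u0, u3, u4, u13, u14, u16, uw', h]
      exact hmem
    · simp [block, eval, u0, u3, u4, u13, u14, u16, uw', h]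
      exact hmem

end GroupIdentification

/-! ### The decision procedure -/

namespace GroupIdentification

open Finset RAM RAM.Prog Branching

theorem down_mul_runs {H N c d a : ℕ} {s : State} (hs : s.Bdd H) (hH : 1 ≤ H) (hc2 : c ≠ 2)
    (hd2 : d ≠ 2) (ha2 : a ≠ 2) (hcd : c ≠ d) (hca : c ≠ a) (hda : d ≠ a) (hN : s.reg c ≤ N)
    (ha : 1 ≤ s.reg a) (hdH : s.reg d * s.reg a ^ s.reg c ≤ H) :
    Runs H (N * 7 + 1) (down c (mul d d a)) s fun t => t.reg d = s.reg d * s.reg a ^ s.reg c := by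
  refine (Runs.down (K := 2) (fun k t => t.reg d * s.reg a ^ k = s.reg d * s.reg a ^ s.reg c)
    hs hH hc2 (by simpa [writes] using hcd) hN
    (fun k t v w h => by simpa [hcd.symm, hd2] using h) rfl ?_).mono le_rfl ?_
  · rintro k t ht - - - hframe - i1
    have hta : t.reg a = s.reg a := hframe a hca.symm ha2 (by simpa [writes] using hda.symm)
    refine (Runs.straight ht ?_).mono le_rfl ?_
    · simp only [Safe, hta]
      refine le_trans ?_ hdH
      rw [← i1, pow_succ']
      exact Nat.mul_le_mul_left _ (Nat.le_mul_of_pos_right _ (Nat.pow_pos ha))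
    · rintro u - rfl
      simp only [eval, State.setReg_reg, Function.update_self, hta]
      rw [← i1, pow_succ']
      ring
  · rintro t - ⟨i1, -⟩
    simpa using i1

/-- With `p = n + 1` in register `4`: the base `B = (4 p)^p` goes to register `9`, the number
`2^κ` of codes to register `12`, and the threshold `B^(p - k)` to register `13`. -/
def powers : Prog :=
  seq (block [const 9 1, copy 10 4, add 11 4 4, add 11 11 11]) (seq (down 10 (mul 9 9 11))
    (seq (block [const 12 1, const 15 2, copy 10 1]) (seq (down 10 (mul 12 12 15))
      (seq (block [const 13 1, sub 10 4 14]) (seq (down 10 (mul 13 13 9)) (const 14 0))))))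

theorem powers_runs {H n κ k N B : ℕ} {s : State} (hs : s.Bdd H) (h1 : s.reg 1 = κ)
    (h4 : s.reg 4 = n + 1) (h14 : s.reg 14 = k) (hB : B = (4 * (n + 1)) ^ (n + 1))
    (hBH : B ≤ H) (hκ : 2 ^ κ ≤ H) (hth : B ^ (n + 1 - k) ≤ H) (hnN : n + 1 ≤ N) (hκN : κ ≤ N) :
    Runs H (60 * N) powers s fun t =>
      t.reg 9 = B ∧ t.reg 12 = 2 ^ κ ∧ t.reg 13 = B ^ (n + 1 - k) ∧ t.reg 14 = 0 := by
  have hB0 : 4 * (n + 1) ≤ B := by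
    rw [hB]
    exact Nat.le_self_pow (by omega) _
  refine ((Runs.straight hs ?_).seq (k' := (N * 7 + 1) + (8 + ((N * 7 + 1) + (6 +
    ((N * 7 + 1) + 2))))) ?_).mono (k := 10 + ((N * 7 + 1) + (8 + ((N * 7 + 1) + (6 +
    ((N * 7 + 1) + 2)))))) (by omega) fun _ _ h => h
  · simp [block, Safe, eval, h4]
    omega
  rintro t ht rfl
  set t := eval (block [const 9 1, copy 10 4, add 11 4 4, add 11 11 11]) s with htdef
  have t1 : t.reg 1 = κ := by simp [htdef, block, eval, h1]
  have t4 : t.reg 4 = n + 1 := by simp [htdef, block, eval, h4]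
  have t9 : t.reg 9 = 1 := by simp [htdef, block, eval]
  have t10 : t.reg 10 = n + 1 := by simp [htdef, block, eval, h4]
  have t11 : t.reg 11 = 4 * (n + 1) := by simp [htdef, block, eval, h4]; omega
  have t14 : t.reg 14 = k := by simp [htdef, block, eval, h14]
  clear_value t
  refine (down_mul_runs (N := N) ht (by omega) (by decide) (by decide) (by decide) (by decide)
    (by decide) (by decide) (by omega) (by omega) (by rw [t9, t10, t11, one_mul, ← hB]; exact hBH)
    ).frame.seq ?_
  rintro u hu ⟨u9, hframe, -⟩
  rw [t9, t10, t11, one_mul, ← hB] at u9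
  have u1 : u.reg 1 = κ := by rw [hframe 1 (by decide), t1]
  have u4 : u.reg 4 = n + 1 := by rw [hframe 4 (by decide), t4]
  have u14 : u.reg 14 = k := by rw [hframe 14 (by decide), t14]
  clear hframe
  refine (Runs.straight hu ?_).seq ?_
  · simp [block, Safe]
    omega
  rintro v hv rfl
  set v := eval (block [const 12 1, const 15 2, copy 10 1]) u with hvdef
  have v4 : v.reg 4 = n + 1 := by simp [hvdef, block, eval, u4]
  have v9 : v.reg 9 = B := by simp [hvdef, block, eval, u9]
  have v10 : v.reg 10 = κ := by simp [hvdef, block, eval, u1]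
  have v12 : v.reg 12 = 1 := by simp [hvdef, block, eval]
  have v14 : v.reg 14 = k := by simp [hvdef, block, eval, u14]
  have v15 : v.reg 15 = 2 := by simp [hvdef, block, eval]
  clear_value v
  refine (down_mul_runs (N := N) hv (by omega) (by decide) (by decide) (by decide) (by decide)
    (by decide) (by decide) (by omega) (by omega) (by rw [v12, v10, v15, one_mul]; exact hκ)
    ).frame.seq ?_
  rintro w hw ⟨w12, hframe, -⟩
  rw [v12, v10, v15, one_mul] at w12
  have w4 : w.reg 4 = n + 1 := by rw [hframe 4 (by decide), v4]
  have w9 : w.reg 9 = B := by rw [hframe 9 (by decide), v9]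
  have w14 : w.reg 14 = k := by rw [hframe 14 (by decide), v14]
  clear hframe
  refine (Runs.straight hw ?_).seq ?_
  · simp [block, Safe]
    omega
  rintro y hy rfl
  set y := eval (block [const 13 1, sub 10 4 14]) w with hydef
  have y9 : y.reg 9 = B := by simp [hydef, block, eval, w9]
  have y10 : y.reg 10 = n + 1 - k := by simp [hydef, block, eval, w4, w14]
  have y12 : y.reg 12 = 2 ^ κ := by simp [hydef, block, eval, w12]
  have y13 : y.reg 13 = 1 := by simp [hydef, block, eval]
  clear_value y
  refine (down_mul_runs (N := N) hy (by omega) (by decide) (by decide) (by decide) (by decide)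
    (by decide) (by decide) (by omega) (by omega) (by rw [y13, y10, y9, one_mul]; exact hth)
    ).frame.seq ?_
  rintro z hz ⟨z13, hframe, -⟩
  rw [y13, y10, y9, one_mul] at z13
  have z9 : z.reg 9 = B := by rw [hframe 9 (by decide), y9]
  have z12 : z.reg 12 = 2 ^ κ := by rw [hframe 12 (by decide), y12]
  clear hframe
  refine (Runs.straight hz (by simp [Safe])).mono le_rfl ?_
  rintro a - rfl
  simp [eval, z9, z12, z13]

/-- The sums over all sets are computed and compared with the threshold. -/
def compareSums : Prog :=
  seq (down 12 exclusionRound) (block [sub 13 13 14, const 2 1, sub 0 2 13])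

theorem compareSums_runs {H n B G κ θ : ℕ} {x : List Bool} {s : State} (hs : s.Bdd H)
    (hr : Ready x n B s) (hn : n ≤ x.length) (hx : posK n ≤ x.length)
    (hH : 16 * ((x.length + 1) * (x.length + 1)) ≤ H)
    (hG : ∀ j ≤ n, ∀ X v,
      weightSum (n + 1) (arc x n) (avoidWeight (inside x n) B X) j v ≤ G)
    (h12 : s.reg 12 = 2 ^ κ) (h13 : s.reg 13 = θ) (h14 : s.reg 14 = 0)
    (hθ : θ + 2 ^ κ * G ≤ H) (hκ : (wordS x n).card = κ) :
    Runs H (320 * 2 ^ κ * (x.length + 1) ^ 4) compareSums s fun t => t.reg 0 =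
      if (∑ X ∈ (wordS x n).powerset with Odd X.card,
        weightSum (n + 1) (arc x n) (avoidWeight (inside x n) B X) n n) + θ ≤
        ∑ X ∈ (wordS x n).powerset with ¬ Odd X.card,
        weightSum (n + 1) (arc x n) (avoidWeight (inside x n) B X) n n then 1 else 0 := by
  have hHx : x.length + 1 ≤ H := le_trans (by nlinarith) hH
  have hpos : 1 ≤ 2 ^ κ * (x.length + 1) ^ 4 :=
    Nat.mul_pos (Nat.pow_pos two_pos) (Nat.pow_pos (Nat.succ_pos _))
  have hpow : 2 ^ κ ≤ 2 ^ κ * (x.length + 1) ^ 4 :=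
    Nat.le_mul_of_pos_right _ (Nat.pow_pos (Nat.succ_pos _))
  set D : ℕ → Finset ℕ := decode (fun v => bit x (posS n + v)) n with hD
  set odd : ℕ → ℕ := fun c => if Odd (D c).card then codeTerm x n B c else 0 with hodd
  set even : ℕ → ℕ := fun c => if ¬ Odd (D c).card then codeTerm x n B c else 0 with heven
  have hterm : ∀ c, codeTerm x n B c ≤ G := fun c => hG n le_rfl _ _
  have hoddG : ∀ c, odd c ≤ G := fun c => by
    have := hterm c
    simp only [hodd]
    split_ifs <;> omega
  have hevenG : ∀ c, even c ≤ G := fun c => by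
    have := hterm c
    simp only [heven]
    split_ifs <;> omega
  have hsumle : ∀ (f : ℕ → ℕ), (∀ c, f c ≤ G) → ∀ k < 2 ^ κ,
      θ + ∑ c ∈ Ico (k + 1) (2 ^ κ), f c + G ≤ H := by
    intro f hf k hk
    have h1 : ∑ c ∈ Ico (k + 1) (2 ^ κ), f c ≤ (2 ^ κ - (k + 1)) * G := by
      refine (sum_le_card_nsmul _ _ G fun c _ => hf c).trans_eq ?_
      rw [Nat.card_Ico, smul_eq_mul]
    have h2 : (2 ^ κ - (k + 1)) * G + G ≤ 2 ^ κ * G := by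
      rw [← Nat.succ_mul]
      exact Nat.mul_le_mul_right _ (by omega)
    omega
  have hfinal : ∀ q : ℕ → Prop, [DecidablePred q] →
      ∑ c ∈ range (2 ^ κ), (if q (D c).card then codeTerm x n B c else 0) =
      ∑ X ∈ (wordS x n).powerset with q X.card,
        weightSum (n + 1) (arc x n) (avoidWeight (inside x n) B X) n n := by
    intro q _
    rw [sum_filter, wordS, ← sum_range_two_pow_decode, ← hκ]
    rfl
  refine ((Runs.down (K := 300 * (x.length + 1) ^ 4) (N := 2 ^ κ) (fun k t =>
      (∀ a < x.length, t.mem a = s.mem a) ∧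
      t.reg 13 = θ + ∑ c ∈ Ico k (2 ^ κ), odd c ∧ t.reg 14 = ∑ c ∈ Ico k (2 ^ κ), even c)
      hs (by omega) (by decide) (by decide) h12.le
      (fun k t v w h => by simpa using h) ?_ ?_).seq (k' := 8) ?_).mono (k' := _) ?_ fun _ _ h => h
  · rw [h12, h13, h14]
    exact ⟨fun _ _ => rfl, by simp, by simp⟩
  · rintro k y hy hk hyk - hframe - ⟨i1, i2, i3⟩
    rw [h12] at hk
    have yr : Ready x n B y := hr.of_eq
      (fun r h => by
        obtain ⟨a1, a2, a3⟩ := (by decide : ∀ r ∈ [0, 3, 4, 5, 6, 9], r ≠ 12 ∧ r ≠ 2 ∧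
          r ∉ exclusionRound.writes) r h
        exact hframe r a1 a2 a3) i1
    clear hframe
    have b1 := hsumle odd hoddG k hk
    have b2 := hsumle even hevenG k hk
    refine (exclusionRound_runs hy yr hn hx hH hG (by rw [i2]; exact b1) (by rw [i3]; omega)).mono
      le_rfl ?_
    rintro t - ⟨a1, a2, a3⟩
    refine ⟨fun a ha => by rw [a1 a ha, i1 a ha], ?_, ?_⟩
    · rw [a2, i2, hyk, sum_eq_sum_Ico_succ_bot hk, add_assoc, add_comm (odd k)]
    · rw [a3, i3, hyk, sum_eq_sum_Ico_succ_bot hk, add_comm (even k)]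
  · rintro y hy ⟨⟨-, i2, i3⟩, -⟩
    rw [← range_eq_Ico] at i2 i3
    have i2' := i2.trans (congrArg (θ + ·) (hfinal fun m => Odd m))
    have i3' := i3.trans (hfinal fun m => ¬ Odd m)
    refine (Runs.straight hy ?_).mono le_rfl ?_
    · simp [block, Safe]
      omega
    · rintro t - rfl
      rw [add_comm _ θ, ← i2', ← i3']
      simp [block, eval]
      split_ifs <;> omega
  · nlinarith

/-- Decide the problem, if register `1` holds a number that is at most `|x| + 1`. -/
def solve : Prog :=
  seq parse (branch 9 (const 0 0) (seq powers compareSums))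

/-- The exponent in the bound `H` leaves room for the largest numbers that occur: with
`N = |x| + 1`, the sum over all `2^κ ≤ (4 N)^N` codes of numbers up to
`(4 p)^n B^p ≤ (4 N)^(N + N²)`. -/
theorem solve_runs {H κ : ℕ} {x : List Bool} {s : State} (hs : s.Bdd H)
    (hH : (4 * (x.length + 1)) ^ ((x.length + 1) * (x.length + 1) + 3 * (x.length + 1) + 4) ≤ H)
    (h0 : s.reg 0 = x.length) (h1 : s.reg 1 = κ) (hκ : κ ≤ x.length + 1)
    (hm : ∀ a, s.mem a = (bit x a).toNat) :
    Runs H (600 * 2 ^ κ * (x.length + 1) ^ 4) solve s fun t =>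
      ((x, κ) ∈ GCAI LSR → t.reg 0 = 1) ∧ ((x, κ) ∉ GCAI LSR → t.reg 0 = 0) := by
  set N := x.length + 1 with hN
  have hN1 : 1 ≤ N := Nat.succ_pos _
  have hA1 : 1 ≤ 4 * N := by omega
  have hup : ∀ e ≤ N * N + 3 * N + 4, (4 * N) ^ e ≤ H := fun e he =>
    (Nat.pow_le_pow_right hA1 he).trans hH
  have hNe : N ≤ N * N + 3 * N + 4 := by omega
  have hH1 : 16 * (N * N) ≤ H := by
    refine le_trans (le_of_eq ?_) (hup 2 (by omega))
    ring
  have hH2 : 2 ^ N ≤ H := (Nat.pow_le_pow_left (by omega) N).trans (hup N hNe)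
  have hpos : 1 ≤ 2 ^ κ * N ^ 4 := Nat.mul_pos (Nat.pow_pos two_pos) (Nat.pow_pos hN1)
  have hNle : N ≤ 2 ^ κ * N ^ 4 :=
    (Nat.le_self_pow (by omega) N).trans (Nat.le_mul_of_pos_left _ (Nat.pow_pos two_pos))
  have h2N : 2 ^ x.length ≤ 2 ^ N := Nat.pow_le_pow_right two_pos (by omega)
  refine ((parse_runs hs hH1 (h2N.trans hH2) h0 h1 hκ hm).seq
    (k' := (60 * N + 320 * 2 ^ κ * N ^ 4) + 1) ?_).mono ?_ fun _ _ h => h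
  · rintro t ht ⟨n, hn, hn1, hn0, t0, t1, t3, t4, t5, t6, t9, t14, tm⟩
    have hmem := mem_GCAI_LSR_iff (κ := κ) hn1 hn0
    refine Runs.branch ht (fun h => ?_) (fun h => ?_)
    · have hnot : (x, κ) ∉ GCAI LSR := fun hin => h (t9.2 (hmem.1 hin).1)
      refine (Runs.straight ht (by simp [Safe])).mono ?_ ?_
      · simp only [size]
        omega
      · rintro u - rfl
        exact ⟨fun hin => absurd hin hnot, fun _ => by simp [eval]⟩
    · have hv : ValidWord x κ n := t9.1 h
      have hκn : κ ≤ n := by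
        rw [← hv.card]
        exact (card_filter_le _ _).trans_eq (card_range n)
      set B := (4 * (n + 1)) ^ (n + 1) with hB
      set G := (4 * (n + 1)) ^ n * B ^ (n + 1) with hGdef
      have hB1 : 1 ≤ B := Nat.pow_pos (by omega)
      have hG : ∀ j ≤ n, ∀ X v,
          weightSum (n + 1) (arc x n) (avoidWeight (inside x n) B X) j v ≤ G := fun j hj X v =>
        (weightSum_le (avoidWeight_le hB1 X) j v).trans (Nat.mul_le_mul
          (Nat.pow_le_pow_right (by omega) hj) (Nat.pow_le_pow_right hB1 (by omega)))
      have hBN : B ≤ (4 * N) ^ N := (Nat.pow_le_pow_left (by omega) _).trans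
        (Nat.pow_le_pow_right hA1 (by omega))
      have hBp : ∀ e ≤ n + 1, B ^ e ≤ (4 * N) ^ (N * N) := fun e he => by
        rw [pow_mul]
        exact (Nat.pow_le_pow_left hBN e).trans (Nat.pow_le_pow_right (Nat.pow_pos hA1) (by omega))
      have hGN : G ≤ (4 * N) ^ (N + N * N) := by
        rw [pow_add]
        exact Nat.mul_le_mul ((Nat.pow_le_pow_left (by omega) _).trans
          (Nat.pow_le_pow_right hA1 (by omega))) (hBp _ le_rfl)
      have h2κ : 2 ^ κ ≤ (4 * N) ^ N := (Nat.pow_le_pow_left (by omega) _).trans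
        (Nat.pow_le_pow_right hA1 (by omega))
      have hθ : B ^ (n + 1 - wordVal (x.drop (posK n))) + 2 ^ κ * G ≤ H := by
        have e1 : B ^ (n + 1 - wordVal (x.drop (posK n))) ≤ (4 * N) ^ (N + (N + N * N)) :=
          (hBp _ (Nat.sub_le _ _)).trans (Nat.pow_le_pow_right hA1 (by omega))
        have e2 : 2 ^ κ * G ≤ (4 * N) ^ (N + (N + N * N)) := by
          rw [pow_add (4 * N) N]
          exact Nat.mul_le_mul h2κ hGN
        have e3 := hup (N + (N + N * N) + 1) (by omega)
        rw [pow_succ] at e3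
        refine (Nat.add_le_add e1 e2).trans (le_trans ?_ e3)
        rw [← mul_two]
        exact Nat.mul_le_mul_left _ (by omega)
      refine (powers_runs (N := N) ht t1 t4 t14 hB (hBN.trans (hup _ hNe))
        (h2κ.trans (hup _ hNe)) (by omega) (by omega) hκ).frame.seq ?_
      rintro u hu ⟨⟨u9, u12, u13, u14⟩, hframe, hmemeq⟩
      have ur : Ready x n B u :=
        ⟨by rw [hframe 0 (by decide), t0], by rw [hframe 3 (by decide), t3],
          by rw [hframe 4 (by decide), t4], by rw [hframe 5 (by decide), t5],
          by rw [hframe 6 (by decide), t6], u9, fun a _ => by rw [hmemeq rfl, tm]⟩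
      have hiff := odd_sum_add_pow_le_iff (p := n + 1) (E := arc x n) (inside x n) B (wordS x n) n n
        (n + 1 - wordVal (x.drop (posK n)))
        (Nat.pow_lt_pow_right (by omega) (Nat.lt_succ_self n))
      refine (compareSums_runs hu ur hn hv.length hH1 hG u12 u13 u14 hθ hv.card).mono le_rfl ?_
      rintro y - hy
      rw [hy]
      constructor
      · intro hin
        exact if_pos (hiff.2 (hmem.1 hin).2)
      · intro hnot
        exact if_neg fun hle => hnot (hmem.2 ⟨hv, hiff.1 hle⟩)
  · nlinarith

/-- The parameter is cut down to at most `|x| + 1`, so that all numbers are bounded in terms of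
`|x|`, and then the problem is solved. -/
def gcaiProgram : Prog :=
  seq (block [const 2 1, add 3 0 2, sub 3 1 3, sub 1 1 3, const 3 0]) solve

theorem mem_GCAI_min_iff (f : AggregationRule) (x : List Bool) (κ : ℕ) :
    (x, min κ (x.length + 1)) ∈ GCAI f ↔ (x, κ) ∈ GCAI f := by
  rcases le_or_gt κ (x.length + 1) with h | h
  · rw [min_eq_left h]
  · have hno : ∀ m, x.length + 1 ≤ m → (x, m) ∉ GCAI f := by
      rintro m hm ⟨I, hI, -⟩
      obtain ⟨rfl, rfl⟩ := Prod.mk.inj hI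
      have h1 := I.posK_le_length
      have h2 : I.S.card ≤ I.n := by simpa using card_le_univ I.S
      have h3 : I.n ≤ posK I.n := by simp only [posK, posSign]; omega
      omega
    exact ⟨fun hin => absurd hin (hno _ (by omega)), fun hin => absurd hin (hno _ h.le)⟩

theorem len_pow_le {N : ℕ} (hN : 1 ≤ N) :
    len ((4 * N) ^ (N * N + 3 * N + 4)) ≤ 40 * N ^ 3 := by
  set m := N * N + 3 * N + 4 with hm
  have h1 : 4 * N < 2 ^ (N + 2) := by
    have : N < 2 ^ N := Nat.lt_two_pow_self
    rw [pow_add]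
    omega
  have h2 : Nat.size ((4 * N) ^ m) ≤ (N + 2) * m := by
    rw [Nat.size_le, pow_mul]
    exact Nat.pow_lt_pow_left h1 (by omega)
  have h3 : m ≤ 8 * N ^ 2 := by rw [hm]; nlinarith
  have h4 : (N + 2) * m ≤ 3 * N * (8 * N ^ 2) := Nat.mul_le_mul (by omega) h3
  have h5 : 1 ≤ N ^ 3 := Nat.pow_pos hN
  have h6 : 3 * N * (8 * N ^ 2) = 24 * N ^ 3 := by ring
  unfold len
  omega

theorem len_le_two_pow (κ : ℕ) : len κ ≤ 2 ^ κ + 1 := by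
  have h : κ.size ≤ κ := Nat.size_le.2 Nat.lt_two_pow_self
  have : κ < 2 ^ κ := Nat.lt_two_pow_self
  unfold len
  omega

theorem gcaiProgram_decides : (GCAI LSR).DecidedInTime gcaiProgram fun x κ =>
    1000000 * 2 ^ κ * (x.length + 1) ^ 10 := by
  intro x κ
  set N := x.length + 1 with hN
  have hN1 : 1 ≤ N := Nat.succ_pos _
  set H := (4 * N) ^ (N * N + 3 * N + 4) with hH
  have hHN : 4 * N ≤ H := Nat.le_self_pow (by omega) _
  set s := eval (block [const 2 1, add 3 0 2, sub 3 1 3, sub 1 1 3, const 3 0]) (init x κ)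
    with hsdef
  have sreg : ∀ r, s.reg r = if r = 0 then x.length else if r = 1 then min κ N
      else if r = 2 then 1 else 0 := by
    intro r
    have hmin : κ - (κ - (x.length + 1)) = min κ N := by omega
    by_cases h3 : r = 3
    · simp [hsdef, block, eval, init, h3]
    · by_cases h1 : r = 1
      · simp [hsdef, block, eval, init, h1, hmin]
      · by_cases h2 : r = 2
        · simp [hsdef, block, eval, h2]
        · simp [hsdef, block, eval, init, h1, h2, h3]
  have smem : ∀ a, s.mem a = (bit x a).toNat := fun a => by
    simp [hsdef, block, eval, init, bit]
  have hs : s.Bdd H := by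
    refine ⟨fun r => ?_, fun a => ?_⟩
    · rw [sreg]
      split_ifs <;> omega
    · rw [smem]
      exact (Bool.toNat_le _).trans (by omega)
  have hexec : ∃ c, Exec (block [const 2 1, add 3 0 2, sub 3 1 3, sub 1 1 3, const 3 0])
      (init x κ) s c ∧ c ≤ 4 * len κ + 2 * len N + 10 := by
    refine ⟨_, .seq (.const ..) (.seq (.add ..) (.seq (.sub ..) (.seq (.sub ..)
      (.seq (.const ..) (.skip _))))), ?_⟩
    have l0 : len 0 = 1 := by simp [len]
    have l1 : len 1 = 2 := by simp [len]
    have l2 : len x.length ≤ len N := len_mono (by omega)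
    have l3 : len (κ - N) ≤ len κ := len_mono (Nat.sub_le _ _)
    simp [init, l0, l1, ← hN]
    omega
  obtain ⟨c, hc, hcle⟩ := hexec
  obtain ⟨t, d, hd, hdle, -, hyes, hno⟩ := solve_runs hs le_rfl (by rw [sreg]; rfl)
    (by rw [sreg]; rfl) (min_le_right κ N) smem
  rw [mem_GCAI_min_iff] at hyes hno
  refine ⟨t, c + d, .seq hc hd, ?_, hyes, hno⟩
  have hd' : d ≤ 600 * 2 ^ κ * N ^ 4 * (40 * N ^ 3) ^ 2 := by
    refine hdle.trans (Nat.mul_le_mul ?_ (Nat.pow_le_pow_left (len_pow_le hN1) 2))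
    gcongr
    · exact one_le_two
    · exact min_le_left _ _
  have e1 : 600 * 2 ^ κ * N ^ 4 * (40 * N ^ 3) ^ 2 = 960000 * (2 ^ κ * N ^ 10) := by ring
  have e2 : 1 ≤ 2 ^ κ := Nat.pow_pos two_pos
  have e3 : N ≤ N ^ 10 := Nat.le_self_pow (by omega) _
  have e4 : 2 ^ κ ≤ 2 ^ κ * N ^ 10 := Nat.le_mul_of_pos_right _ (Nat.pow_pos hN1)
  have e5 : N ^ 10 ≤ 2 ^ κ * N ^ 10 := Nat.le_mul_of_pos_left _ e2
  have e6 := len_le_two_pow κ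
  have e7 : len N ≤ N + 1 := by
    have : N.size ≤ N := Nat.size_le.2 Nat.lt_two_pow_self
    unfold len
    omega
  have e8 : 1000000 * 2 ^ κ * N ^ 10 = 1000000 * (2 ^ κ * N ^ 10) := by ring
  change c + d ≤ 1000000 * 2 ^ κ * N ^ 10
  rw [e8]
  rw [e1] at hd'
  omega

end GroupIdentification

theorem mainTheorem2 :
    (GroupIdentification.GCAI GroupIdentification.LSR).IsFPT ∧
      (GroupIdentification.GCAI GroupIdentification.LSR).SolvableInOStar (fun ℓ => 2 ^ ℓ) := by
  refine ⟨⟨GroupIdentification.gcaiProgram, fun κ => 1000000 * 2 ^ κ, 10, ?_,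
    GroupIdentification.gcaiProgram_decides⟩,
    ⟨GroupIdentification.gcaiProgram, 1000000, 10, GroupIdentification.gcaiProgram_decides⟩⟩
  have hpow : Primrec fun κ : ℕ => 2 ^ κ := by
    refine (Primrec.nat_rec₁ 1 (f := fun _ r => r * 2)
      (Primrec.nat_mul.comp Primrec.snd (Primrec.const 2))).of_eq fun n => ?_
    induction n with
    | zero => rfl
    | succ n ih => rw [pow_succ, ← ih]
  exact (Primrec.nat_mul.comp (Primrec.const 1000000) hpow).to_comp
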